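/- Let $L>0$, $C>0$, $I=(0,L)$ and $n\in\{1,2,3,\dots\}$. There is a constant $c=c(n,L,C)>0$ such that the following holds for every real function $v_0\in C^\infty([0,L])$ with $\sup_{[0,L]}|v_0|\le C$. Let $S=-\Delta_D^I+v_0$ in $L^2(I)$, where $-\Delta_D^I$ is the operator associated with the quadratic form $\psi\mapsto\int_0^L|\psi'|^2$ on $H^1_0(I)$ (so $S=-\frac{d^2}{ds^2}+v_0$ with Dirichlet conditions at $0$ and $L$). Its eigenvalues can be arranged in a sequence $\mu_1\le\mu_2\le\dots$ that repeats each eigenvalue according to its multiplicity. Let $\phi_n$ be any real eigenfunction of $S$ for $\mu_n$ with $\|\phi_n\|_{L^2(I)}=1$. Then (after modification on a null set) $\phi_n\in C^\infty([0,L])$, the function $\phi_n$ has exactly $n+1$ zeros $0=s^0<s^1<\dots<s^n=L$ in $[0,L]$, and, with $I_n=I\setminus\{s^1,\dots,s^{n-1}\}$: (i) $(n\pi/L)^2-C\le\mu_n\le(n\pi/L)^2+C$; (ii) $\|\phi_n\|_{C^2([0,L])}\le c^{-1}$, where $\|u\|_{C^2([0,L])}=\sup|u|+\sup|u'|+\sup|u''|$;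 (iii) $\mu_{n+1}-\mu_n\ge c$; (iv) $s^{k+1}-s^k\ge c$ for all $k\in\{0,\dots,n-1\}$; (v) $|\phi_n(s)|\ge c\,\mathrm{dist}(s,\partial I_n)$ for all $s\in I$. -/

import Mathlib

open scoped ContDiff

noncomputable section

namespace SturmDirichlet

open MeasureTheory

/-- The real Hilbert space `L²(0, L)`. -/
abbrev L2 (L : ℝ) : Type :=
  Lp ℝ 2 ((volume : Measure ℝ).restrict (Set.Ioo 0 L))

/-- The pairs `(ψ, ψ')` with `ψ ∈ C_c^∞(0, L)`, as elements of `L²(0, L) × L²(0, L)`. -/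
def testPairs (L : ℝ) : Set (L2 L × L2 L) :=
  {p | ∃ ψ : ℝ → ℝ, ContDiff ℝ ∞ ψ ∧ HasCompactSupport ψ ∧ tsupport ψ ⊆ Set.Ioo 0 L ∧
    (p.1 : ℝ → ℝ) =ᵐ[volume.restrict (Set.Ioo 0 L)] ψ ∧
    (p.2 : ℝ → ℝ) =ᵐ[volume.restrict (Set.Ioo 0 L)] deriv ψ}

/-- The Sobolev space `H¹₀(0, L)`, i.e. the closure of `C_c^∞(0, L)` in the `H¹` norm. An element
is recorded as the pair `(u, u')` of the function and its weak derivative; the linear span only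
serves to have a subspace by construction (the test pairs already form one). -/
def H10 (L : ℝ) : Submodule ℝ (L2 L × L2 L) :=
  (Submodule.span ℝ (testPairs L)).topologicalClosure

/-- The graph of the Dirichlet Laplacian `-Δ_D` on `(0, L)`: the operator in `L²(0, L)` associated
with the quadratic form `u ↦ ∫ (u')²` with form domain `H¹₀(0, L)`. Thus `(f, h)` is in the graph
iff `f ∈ H¹₀(0, L)` and `⟪f', w'⟫ = ⟪h, w⟫` for all `w ∈ H¹₀(0, L)`. -/
def dirichletLaplacian (L : ℝ) : Submodule ℝ (L2 L × L2 L) where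
  carrier := {p | ∃ g : L2 L, (p.1, g) ∈ H10 L ∧
    ∀ q ∈ H10 L, inner ℝ g q.2 = inner ℝ p.2 q.1}
  zero_mem' := ⟨0, (H10 L).zero_mem, fun q _ => by simp⟩
  add_mem' := by
    rintro a b ⟨g, hg, hg'⟩ ⟨k, hk, hk'⟩
    refine ⟨g + k, (H10 L).add_mem hg hk, fun q hq => ?_⟩
    rw [inner_add_left, hg' q hq, hk' q hq, ← inner_add_left]
    rfl
  smul_mem' := by
    rintro c a ⟨g, hg, hg'⟩
    refine ⟨c • g, (H10 L).smul_mem c hg, fun q hq => ?_⟩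
    rw [inner_smul_left, hg' q hq, ← inner_smul_left]
    rfl

/-- The graph of the one-dimensional Schrödinger operator `S = -Δ_D + v` in `L²(0, L)`. -/
def schrodinger (L : ℝ) (v : ℝ → ℝ) : Submodule ℝ (L2 L × L2 L) where
  carrier := {p | ∃ k : L2 L, (p.1, k) ∈ dirichletLaplacian L ∧
    (p.2 : ℝ → ℝ) =ᵐ[volume.restrict (Set.Ioo 0 L)] fun s => k s + v s * p.1 s}
  zero_mem' := by
    refine ⟨0, (dirichletLaplacian L).zero_mem, ?_⟩
    filter_upwards [Lp.coeFn_zero ℝ 2 ((volume : Measure ℝ).restrict (Set.Ioo 0 L))] with s hs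
    have hs' : (0 : L2 L) s = 0 := hs
    change (0 : L2 L) s = (0 : L2 L) s + v s * (0 : L2 L) s
    rw [hs']
    ring
  add_mem' := by
    rintro a b ⟨k, hk, hk'⟩ ⟨l, hl, hl'⟩
    refine ⟨k + l, (dirichletLaplacian L).add_mem hk hl, ?_⟩
    filter_upwards [hk', hl', Lp.coeFn_add k l, Lp.coeFn_add a.1 b.1, Lp.coeFn_add a.2 b.2]
      with s h1 h2 h3 h4 h5
    simp only [Prod.fst_add, Prod.snd_add, h3, h4, h5, Pi.add_apply, h1, h2]
    ring
  smul_mem' := by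
    rintro c a ⟨k, hk, hk'⟩
    refine ⟨c • k, (dirichletLaplacian L).smul_mem c hk, ?_⟩
    filter_upwards [hk', Lp.coeFn_smul c k, Lp.coeFn_smul c a.1, Lp.coeFn_smul c a.2]
      with s h1 h2 h3 h4
    simp only [Prod.smul_fst, Prod.smul_snd, h2, h3, h4, Pi.smul_apply, h1, smul_eq_mul]
    ring

/-- The eigenspace `{f ∈ D(S) | S f = t f}` of `S = -Δ_D + v`. -/
def eigenspace (L : ℝ) (v : ℝ → ℝ) (t : ℝ) : Submodule ℝ (L2 L) :=
  (schrodinger L v).comap (LinearMap.id.prod (t • LinearMap.id))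

/-- `μ₁ ≤ μ₂ ≤ …` is the sequence of all eigenvalues of `S = -Δ_D + v`, sorted in non-decreasing
order and repeated according to multiplicity: every real `t` occurs in it exactly as many times as
the dimension of its eigenspace (zero times if `t` is not an eigenvalue). -/
structure IsEigenvalueSeq (L : ℝ) (v : ℝ → ℝ) (μ : ℕ+ → ℝ) : Prop where
  monotone : Monotone μ
  multiplicity : ∀ t : ℝ, Cardinal.mk {n : ℕ+ // μ n = t} = Module.rank ℝ (eigenspace L v t)

/-- The norm of `C²([0, L])`: the sum of the suprema over `[0, L]` of `|u|`, `|u'|`, `|u''|`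
(with one-sided derivatives at the end points). It is meant for `u` of class `C²` on `[0, L]`. -/
def C2Norm (L : ℝ) (u : ℝ → ℝ) : ℝ :=
  ∑ k ∈ Finset.range 3,
    ⨆ s : Set.Icc (0 : ℝ) L, |iteratedDerivWithin k u (Set.Icc 0 L) s|

/-- The open interval `(0, L)` without the zeros of `u`. -/
def nonNodalSet (L : ℝ) (u : ℝ → ℝ) : Set ℝ :=
  {s | s ∈ Set.Ioo 0 L ∧ u s ≠ 0}

end SturmDirichlet

end

/-!
The eigenvalue equation `S f = t f` is the ordinary differential equation `u'' + q u = 0` with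
`q = t - v` and `u 0 = u L = 0`, and everything follows from its Prüfer angle: writing
`u = r sin θ`, `u' = r cos θ`, the angle solves `θ' = cos² θ + q sin² θ`, `θ 0 = 0`. The right-hand
side is bounded and Lipschitz in `θ`, so `θ` exists on all of `[0, L]` (`exists_isPruferAngle`), and
it crosses the multiples of `π` only upwards.

*Spectrum.* The end value `θ L` is continuous and strictly increasing in `t`
(`exists_pruferAngle_family`), and `t` is an eigenvalue, then a simple one, iff `θ L` is a multiple
of `π` (`eigenspace_of_isPruferAngle`). Hence `μₙ` is the unique parameter with `θ L = n π`
(`exists_eigenvalueSeq`). If `q` is everywhere at least (at most) `(n π / L)²`, then `θ L` is at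
least (at most) `n π`: apply to `θ` the increasing function `α` with `tan α = k tan θ`,
`k = n π / L`, and compare `α'` with `k` (`IsPruferAngle.nat_mul_pi_le`,
`IsPruferAngle.le_nat_mul_pi`). This locates `μₙ` in `[(n π / L)² - C, (n π / L)² + C]`.

*Operator.* That elements of the eigenspace are classical solutions is elliptic regularity in one
dimension: an element `(f, f')` of `H¹₀` satisfies `f = ∫₀ f'` (`fst_eq_volterra`), and the lemma of
du Bois-Reymond (`exists_ae_eq_const`) turns the weak equation into `f' = const - ∫₀ q f`
(`exists_isSolution_of_mem_eigenspace`). Conversely `(∫₀ h, h) ∈ H¹₀` for every `h ∈ L²` of mean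
zero (`volterra_mem_H10`), so classical solutions lie in the eigenspace
(`mem_eigenspace_of_isSolution`).

*Uniformity.* All constants depend only on a bound `M` for `|q|`. The angle has speed at most
`1 + M`, so consecutive zeros, between which it grows by `π`, are at least `π / (1 + M)` apart.
Grönwall's inequality bounds `θ L` as a function of `t`, so the growth by `π` from `μₙ` to `μₙ₊₁`
costs a definite amount of `t` (`IsPruferAngle.abs_sub_le_of_abs_sub_le`). The energy `u² + u'²` of a
normalized solution is bounded above and below (`IsSolution.energy_bounds`), and a Riccati-type
inequality at each zero gives `|sin θ| ≥ c dist` (`IsPruferAngle.mul_min_le_abs_sin`).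
-/

noncomputable section

namespace SturmDirichlet

open MeasureTheory Set Filter Topology

/-! ### The Prüfer equation -/

/-- The right-hand side `cos² θ + q sin² θ` of the Prüfer equation of `u'' + q u = 0`. -/
def pruferField (q θ : ℝ) : ℝ := Real.cos θ ^ 2 + q * Real.sin θ ^ 2

/-- `θ` is the Prüfer angle on `[0, L]` of the solution of `u'' + q u = 0` with `u 0 = 0`. The
derivatives are two-sided also at the end points, so `θ` is defined on a neighbourhood of
`[0, L]`. -/
structure IsPruferAngle (q : ℝ → ℝ) (L : ℝ) (θ : ℝ → ℝ) : Prop where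
  zero : θ 0 = 0
  hasDerivAt : ∀ s ∈ Icc 0 L, HasDerivAt θ (pruferField (q s) (θ s)) s

lemma pruferField_eq (q θ : ℝ) : pruferField q θ = 1 - (1 - q) * Real.sin θ ^ 2 := by
  unfold pruferField
  rw [Real.cos_sq']
  ring

lemma abs_pruferField_le {q M : ℝ} (hq : |q| ≤ M) (θ : ℝ) : |pruferField q θ| ≤ 1 + M := by
  have h := abs_le.1 hq
  have h1 := Real.sin_sq_add_cos_sq θ
  unfold pruferField
  rw [abs_le]
  constructor <;> nlinarith [sq_nonneg (Real.sin θ), sq_nonneg (Real.cos θ)]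

lemma abs_pruferField_sub_le {q M : ℝ} (hq : |q| ≤ M) (x y : ℝ) :
    |pruferField q x - pruferField q y| ≤ (1 + M) * |x - y| := by
  have h : pruferField q x - pruferField q y
      = (q - 1) * (Real.sin (x - y) * Real.sin (x + y)) := by
    rw [pruferField_eq, pruferField_eq, Real.sin_sub, Real.sin_add]
    have hx := Real.sin_sq_add_cos_sq x
    have hy := Real.sin_sq_add_cos_sq y
    linear_combination (q - 1) * (Real.sin y ^ 2 * hx - Real.sin x ^ 2 * hy)
  have h1 : |q - 1| ≤ 1 + M := by
    have h := abs_le.1 hq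
    rw [abs_le]
    constructor <;> linarith
  have h2 : |Real.sin (x - y) * Real.sin (x + y)| ≤ |x - y| := by
    rw [abs_mul]
    calc |Real.sin (x - y)| * |Real.sin (x + y)| ≤ |x - y| * 1 :=
          mul_le_mul Real.abs_sin_le_abs (Real.abs_sin_le_one _) (abs_nonneg _) (abs_nonneg _)
      _ = |x - y| := mul_one _
  rw [h, abs_mul]
  exact mul_le_mul h1 h2 (abs_nonneg _) ((abs_nonneg _).trans h1)

/-- The right-hand side of the Prüfer equation is bounded, so the Picard–Lindelöf theorem on a
large enough ball yields a solution on the whole interval at once. -/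
theorem exists_isPruferAngle {q : ℝ → ℝ} (hq : Continuous q) {M : ℝ} (hM : ∀ s, |q s| ≤ M)
    {L : ℝ} (hL : 0 < L) : ∃ θ, IsPruferAngle q L θ := by
  have hM0 : 0 ≤ M := (abs_nonneg _).trans (hM 0)
  let K : NNReal := ⟨1 + M, by linarith⟩
  let a : NNReal := ⟨(1 + M) * (L + 1), by positivity⟩
  have h0 : (0 : ℝ) ∈ Icc (-1) (L + 1) := ⟨by norm_num, by linarith⟩
  have hpl : IsPicardLindelof (fun s x => pruferField (q s) x) (⟨0, h0⟩ : Icc (-1) (L + 1))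
      (0 : ℝ) a 0 K K := by
    refine ⟨fun t _ => ?_, fun x _ => ?_, fun t _ x _ => ?_, ?_⟩
    · refine LipschitzOnWith.of_dist_le_mul fun x _ y _ => ?_
      exact abs_pruferField_sub_le (hM t) x y
    · unfold pruferField
      fun_prop
    · exact abs_pruferField_le (hM t) x
    · change (1 + M) * max (L + 1 - 0) (0 - (-1)) ≤ (1 + M) * (L + 1) - 0
      rw [max_eq_left (by linarith)]
      simp
  obtain ⟨θ, h1, h2⟩ := hpl.exists_eq_forall_mem_Icc_hasDerivWithinAt₀
  refine ⟨θ, h1, fun s hs => (h2 s ⟨by linarith [hs.1], by linarith [hs.2]⟩).hasDerivAt ?_⟩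
  exact Icc_mem_nhds (by linarith [hs.1]) (by linarith [hs.2])

lemma monotoneOn_Icc_of_hasDerivAt {f f' : ℝ → ℝ} {a b : ℝ}
    (hf : ∀ s ∈ Icc a b, HasDerivAt f (f' s) s) (h : ∀ s ∈ Icc a b, 0 ≤ f' s) :
    MonotoneOn f (Icc a b) :=
  monotoneOn_of_hasDerivWithinAt_nonneg (convex_Icc a b)
    (fun s hs => (hf s hs).continuousAt.continuousWithinAt)
    (fun s hs => (hf s (interior_subset hs)).hasDerivWithinAt)
    (fun s hs => h s (interior_subset hs))

/-- A function that vanishes at `a` and satisfies `x' ≥ 1 - K x²` stays above a line through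
`(a, 0)`: at a first contact with the line, `x` would be too small to have such a small slope. -/
lemma linear_le_of_riccati {x x' : ℝ → ℝ} {a b ℓ K : ℝ} (hK : 0 ≤ K) (hℓ : b - a ≤ ℓ)
    (hx : ∀ s ∈ Icc a b, HasDerivAt x (x' s) s) (h0 : x a = 0)
    (h : ∀ s ∈ Icc a b, 1 - K * x s ^ 2 ≤ x' s) {s : ℝ} (hs : s ∈ Icc a b) :
    (2 + K * ℓ ^ 2)⁻¹ * (s - a) ≤ x s := by
  set c : ℝ := (2 + K * ℓ ^ 2)⁻¹ with hc
  have hden : 0 < 2 + K * ℓ ^ 2 := by positivity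
  have hcpos : 0 < c := inv_pos.2 hden
  have hc1 : c * (2 + K * ℓ ^ 2) = 1 := inv_mul_cancel₀ hden.ne'
  refine image_le_of_deriv_right_lt_deriv_boundary' (f := fun t => c * (t - a)) (f' := fun _ => c)
    (B := x) (B' := x') (by fun_prop) (fun t _ => ?_) (by simp [h0])
    (fun t ht => (hx t ht).continuousAt.continuousWithinAt)
    (fun t ht => (hx t ⟨ht.1, ht.2.le⟩).hasDerivWithinAt) (fun t ht hcon => ?_) hs
  · simpa using! (((hasDerivAt_id t).sub_const a).const_mul c).hasDerivWithinAt
  · have h1 := h t ⟨ht.1, ht.2.le⟩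
    have h2 : 0 ≤ t - a := by linarith [ht.1]
    have h3 : t - a ≤ ℓ := by linarith [ht.2]
    have h4 : (t - a) ^ 2 ≤ ℓ ^ 2 := by gcongr
    rw [← hcon] at h1
    have h5 : K * (c * (t - a)) ^ 2 ≤ c * (c * (K * ℓ ^ 2)) := by
      have : K * c ^ 2 * (t - a) ^ 2 ≤ K * c ^ 2 * ℓ ^ 2 := by gcongr
      nlinarith
    have h6 : c * (K * ℓ ^ 2) = 1 - 2 * c := by linarith
    rw [h6] at h5
    nlinarith

lemma sin_sq_le_sub_int_mul_pi_sq (x : ℝ) (m : ℤ) :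
    Real.sin x ^ 2 ≤ (x - m * Real.pi) ^ 2 := by
  have h : Real.sin (x - m * Real.pi) ^ 2 = Real.sin x ^ 2 := by
    have h1 : ((-1 : ℝ) ^ m) ^ 2 = 1 := by
      rw [← zpow_natCast, ← zpow_mul, mul_comm, zpow_mul]
      simp
    rw [Real.sin_sub_int_mul_pi, mul_pow, h1, one_mul]
  rw [← h]
  exact sq_le_sq.2 Real.abs_sin_le_abs

lemma le_pruferField {q M : ℝ} (hq : |q| ≤ M) (x : ℝ) (m : ℤ) :
    1 - (1 + M) * (x - m * Real.pi) ^ 2 ≤ pruferField q x := by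
  have h := abs_le.1 hq
  have h1 := sin_sq_le_sub_int_mul_pi_sq x m
  rw [pruferField_eq]
  nlinarith [sq_nonneg (Real.sin x)]

namespace IsPruferAngle

variable {q θ : ℝ → ℝ} {L M : ℝ}

lemma continuousOn (hθ : IsPruferAngle q L θ) : ContinuousOn θ (Icc 0 L) :=
  fun s hs => (hθ.hasDerivAt s hs).continuousAt.continuousWithinAt

lemma abs_sub_le (hθ : IsPruferAngle q L θ) (hM : ∀ s ∈ Icc 0 L, |q s| ≤ M) {a b : ℝ}
    (ha : a ∈ Icc 0 L) (hb : b ∈ Icc 0 L) : |θ b - θ a| ≤ (1 + M) * |b - a| :=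
  (convex_Icc 0 L).norm_image_sub_le_of_norm_hasDerivWithin_le
    (fun s hs => (hθ.hasDerivAt s hs).hasDerivWithinAt)
    (fun s hs => abs_pruferField_le (hM s hs) _) ha hb

/-- After reaching a multiple of `π`, the Prüfer angle stays above it, with a linear bound. -/
lemma le_of_eq_left (hθ : IsPruferAngle q L θ) (hM : ∀ s ∈ Icc 0 L, |q s| ≤ M) {a b : ℝ}
    (ha : 0 ≤ a) (hab : a ≤ b) (hb : b ≤ L) {m : ℤ} (hm : θ a = m * Real.pi) :
    m * Real.pi + (2 + (1 + M) * L ^ 2)⁻¹ * (b - a) ≤ θ b := by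
  have hM0 : 0 ≤ M := (abs_nonneg _).trans (hM a ⟨ha, hab.trans hb⟩)
  have h := linear_le_of_riccati (x := fun s => θ s - m * Real.pi)
    (x' := fun s => pruferField (q s) (θ s)) (a := a) (b := b) (ℓ := L) (K := 1 + M)
    (by linarith) (by linarith)
    (fun s hs => (hθ.hasDerivAt s ⟨ha.trans hs.1, hs.2.trans hb⟩).sub_const _) (by simp [hm])
    (fun s hs => le_pruferField (hM s ⟨ha.trans hs.1, hs.2.trans hb⟩) _ m) (right_mem_Icc.2 hab)
  linarith

/-- Before reaching a multiple of `π`, the Prüfer angle stays below it, with a linear bound. -/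
lemma le_of_eq_right (hθ : IsPruferAngle q L θ) (hM : ∀ s ∈ Icc 0 L, |q s| ≤ M) {a b : ℝ}
    (ha : 0 ≤ a) (hab : a ≤ b) (hb : b ≤ L) {m : ℤ} (hm : θ b = m * Real.pi) :
    θ a ≤ m * Real.pi - (2 + (1 + M) * L ^ 2)⁻¹ * (b - a) := by
  have hM0 : 0 ≤ M := (abs_nonneg _).trans (hM a ⟨ha, hab.trans hb⟩)
  -- The time reversal of the angle satisfies the same differential inequality.
  have h := linear_le_of_riccati (x := fun s => m * Real.pi - θ (-s))
    (x' := fun s => pruferField (q (-s)) (θ (-s))) (a := -b) (b := -a) (ℓ := L) (K := 1 + M)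
    (by linarith) (by linarith)
    (fun s hs => ?_) (by simp [hm])
    (fun s hs => ?_) (right_mem_Icc.2 (by linarith))
  · simp only [neg_neg] at h
    linarith
  · have h1 : -s ∈ Icc 0 L := ⟨by linarith [hs.2], by linarith [hs.1]⟩
    have h2 := ((hθ.hasDerivAt _ h1).scomp s (hasDerivAt_neg s)).const_sub (m * Real.pi)
    simpa using! h2
  · have h1 : -s ∈ Icc 0 L := ⟨by linarith [hs.2], by linarith [hs.1]⟩
    have h2 := le_pruferField (hM _ h1) (θ (-s)) m
    have h3 : (m * Real.pi - θ (-s)) ^ 2 = (θ (-s) - m * Real.pi) ^ 2 := by ring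
    rw [h3]
    exact h2

lemma pos (hθ : IsPruferAngle q L θ) (hM : ∀ s ∈ Icc 0 L, |q s| ≤ M) {s : ℝ}
    (hs : s ∈ Ioc 0 L) : 0 < θ s := by
  have hM0 : 0 ≤ M := (abs_nonneg _).trans (hM s ⟨hs.1.le, hs.2⟩)
  have h := hθ.le_of_eq_left hM le_rfl hs.1.le hs.2 (m := 0) (by simp [hθ.zero])
  have h1 : 0 < (2 + (1 + M) * L ^ 2)⁻¹ * (s - 0) := mul_pos (by positivity) (by linarith [hs.1])
  simp only [Int.cast_zero, zero_mul, zero_add] at h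
  linarith

/-- Grönwall's inequality: the Prüfer angle depends on the potential in a Lipschitz manner. -/
lemma abs_sub_le_of_abs_sub_le {q₁ q₂ θ₁ θ₂ : ℝ → ℝ} (h₁ : IsPruferAngle q₁ L θ₁)
    (h₂ : IsPruferAngle q₂ L θ₂) (hL : 0 < L) (hM : ∀ s ∈ Icc 0 L, |q₁ s| ≤ M) {ε : ℝ}
    (hε : ∀ s ∈ Icc 0 L, |q₂ s - q₁ s| ≤ ε) :
    |θ₂ L - θ₁ L| ≤ ε * Real.exp ((1 + M) * L) := by
  have hM0 : 0 ≤ M := (abs_nonneg _).trans (hM 0 ⟨le_rfl, hL.le⟩)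
  have hε0 : 0 ≤ ε := (abs_nonneg _).trans (hε 0 ⟨le_rfl, hL.le⟩)
  let K : NNReal := ⟨1 + M, by linarith⟩
  have h := dist_le_of_approx_trajectories_ODE_of_mem (v := fun s x => pruferField (q₁ s) x)
    (s := fun _ => univ) (K := K) (f := θ₂) (g := θ₁) (a := 0) (b := L) (εf := ε) (εg := 0)
    (δ := 0)
    (f' := fun s => pruferField (q₂ s) (θ₂ s)) (g' := fun s => pruferField (q₁ s) (θ₁ s))
    (fun t ht => LipschitzOnWith.of_dist_le_mul fun x _ y _ =>
      abs_pruferField_sub_le (hM t ⟨ht.1, ht.2.le⟩) x y)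
    h₂.continuousOn (fun t ht => (h₂.hasDerivAt t ⟨ht.1, ht.2.le⟩).hasDerivWithinAt)
    (fun t ht => ?_) (fun _ _ => trivial)
    h₁.continuousOn (fun t ht => (h₁.hasDerivAt t ⟨ht.1, ht.2.le⟩).hasDerivWithinAt)
    (fun t ht => by simp) (fun _ _ => trivial) (by simp [h₁.zero, h₂.zero]) L ⟨hL.le, le_rfl⟩
  · have hK : (K : ℝ) = 1 + M := rfl
    rw [hK, gronwallBound_of_K_ne_0 (by linarith), Real.dist_eq] at h
    refine h.trans ?_
    simp only [zero_mul, zero_add, add_zero, sub_zero]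
    calc ε / (1 + M) * (Real.exp ((1 + M) * L) - 1) ≤ ε * Real.exp ((1 + M) * L) := by
          apply mul_le_mul (div_le_self hε0 (by linarith)) (by linarith) _ hε0
          have : 1 ≤ Real.exp ((1 + M) * L) := Real.one_le_exp (by positivity)
          linarith
      _ = _ := rfl
  · rw [Real.dist_eq, pruferField, pruferField]
    have h1 : Real.cos (θ₂ t) ^ 2 + q₂ t * Real.sin (θ₂ t) ^ 2
        - (Real.cos (θ₂ t) ^ 2 + q₁ t * Real.sin (θ₂ t) ^ 2)
        = (q₂ t - q₁ t) * Real.sin (θ₂ t) ^ 2 := by ring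
    rw [h1, abs_mul, abs_of_nonneg (sq_nonneg (Real.sin (θ₂ t)))]
    have h2 := hε t ⟨ht.1, ht.2.le⟩
    calc |q₂ t - q₁ t| * Real.sin (θ₂ t) ^ 2 ≤ ε * 1 :=
          mul_le_mul h2 (Real.sin_sq_le_one _) (sq_nonneg _) hε0
      _ = ε := mul_one _

/-- Comparison: a larger potential has a larger Prüfer angle. -/
lemma mono {q₁ q₂ θ₁ θ₂ : ℝ → ℝ} (h₁ : IsPruferAngle q₁ L θ₁)
    (h₂ : IsPruferAngle q₂ L θ₂) (hM : ∀ s ∈ Icc 0 L, |q₂ s| ≤ M)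
    (hq : ∀ s ∈ Icc 0 L, q₁ s ≤ q₂ s) {s : ℝ} (hs : s ∈ Icc 0 L) : θ₁ s ≤ θ₂ s := by
  have hM0 : 0 ≤ M := (abs_nonneg _).trans (hM s hs)
  have key : ∀ ε > 0, θ₁ s - θ₂ s ≤ ε * Real.exp ((2 + M) * s) := by
    intro ε hε
    refine image_le_of_deriv_right_lt_deriv_boundary (f := fun t => θ₁ t - θ₂ t)
      (f' := fun t => pruferField (q₁ t) (θ₁ t) - pruferField (q₂ t) (θ₂ t))
      (B := fun t => ε * Real.exp ((2 + M) * t))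
      (B' := fun t => ε * (Real.exp ((2 + M) * t) * (2 + M)))
      (h₁.continuousOn.sub h₂.continuousOn)
      (fun t ht => ((h₁.hasDerivAt t ⟨ht.1, ht.2.le⟩).sub
        (h₂.hasDerivAt t ⟨ht.1, ht.2.le⟩)).hasDerivWithinAt)
      (by simpa [h₁.zero, h₂.zero] using hε.le) (fun t => ?_) (fun t ht hcon => ?_) hs
    · have h := ((hasDerivAt_id t).const_mul (2 + M)).exp.const_mul ε
      simpa using! h
    · have ht' : t ∈ Icc 0 L := ⟨ht.1, ht.2.le⟩
      have hpos : 0 < ε * Real.exp ((2 + M) * t) := by positivity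
      have h3 := (le_abs_self _).trans (abs_pruferField_sub_le (hM t ht') (θ₁ t) (θ₂ t))
      rw [hcon, abs_of_pos hpos] at h3
      have h4 : pruferField (q₁ t) (θ₁ t) ≤ pruferField (q₂ t) (θ₁ t) := by
        unfold pruferField
        have := mul_le_mul_of_nonneg_right (hq t ht') (sq_nonneg (Real.sin (θ₁ t)))
        linarith
      nlinarith
  by_contra! hlt
  have hE := Real.exp_pos ((2 + M) * s)
  have h5 := key ((θ₁ s - θ₂ s) / 2 / Real.exp ((2 + M) * s)) (by
    apply div_pos _ hE
    linarith)
  rw [div_mul_cancel₀ _ hE.ne'] at h5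
  linarith

/-- Strict comparison at the right end point. -/
lemma strictMono {q₁ q₂ θ₁ θ₂ : ℝ → ℝ} (h₁ : IsPruferAngle q₁ L θ₁)
    (h₂ : IsPruferAngle q₂ L θ₂) (hL : 0 < L) (hM₁ : ∀ s ∈ Icc 0 L, |q₁ s| ≤ M)
    (hM : ∀ s ∈ Icc 0 L, |q₂ s| ≤ M) (hq : ∀ s ∈ Icc 0 L, q₁ s < q₂ s) : θ₁ L < θ₂ L := by
  have hM0 : 0 ≤ M := (abs_nonneg _).trans (hM 0 ⟨le_rfl, hL.le⟩)
  have hle : ∀ s ∈ Icc 0 L, θ₁ s ≤ θ₂ s := fun s hs =>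
    h₁.mono h₂ hM (fun s hs => (hq s hs).le) hs
  refine lt_of_le_of_ne (hle L ⟨hL.le, le_rfl⟩) fun heq => ?_
  -- With the integrating factor, the difference of the two angles is non-decreasing.
  have hmon : MonotoneOn (fun s => (θ₂ s - θ₁ s) * Real.exp ((1 + M) * s)) (Icc 0 L) := by
    refine monotoneOn_Icc_of_hasDerivAt (f' := fun s =>
      (pruferField (q₂ s) (θ₂ s) - pruferField (q₁ s) (θ₁ s)) * Real.exp ((1 + M) * s)
        + (θ₂ s - θ₁ s) * (Real.exp ((1 + M) * s) * (1 + M))) (fun s hs => ?_) (fun s hs => ?_)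
    · have h := ((hasDerivAt_id s).const_mul (1 + M)).exp
      have h' := ((h₂.hasDerivAt s hs).sub (h₁.hasDerivAt s hs)).mul h
      simpa using! h'
    · have h3 := neg_le_of_abs_le (abs_pruferField_sub_le (hM s hs) (θ₂ s) (θ₁ s))
      rw [abs_of_nonneg (sub_nonneg.2 (hle s hs))] at h3
      have h4 : pruferField (q₁ s) (θ₁ s) ≤ pruferField (q₂ s) (θ₁ s) := by
        unfold pruferField
        have := mul_le_mul_of_nonneg_right (hq s hs).le (sq_nonneg (Real.sin (θ₁ s)))
        linarith
      have h5 : 0 ≤ (pruferField (q₂ s) (θ₂ s) - pruferField (q₁ s) (θ₁ s)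
        + (1 + M) * (θ₂ s - θ₁ s)) * Real.exp ((1 + M) * s) := by
        apply mul_nonneg _ (Real.exp_pos _).le
        linarith
      linarith
  have hzero : ∀ s ∈ Icc 0 L, θ₂ s - θ₁ s = 0 := by
    intro s hs
    have h3 := hmon hs ⟨hL.le, le_rfl⟩ hs.2
    simp only [heq, sub_self, zero_mul] at h3
    have h4 : θ₂ s - θ₁ s ≤ 0 := by
      by_contra! h5
      have := mul_pos h5 (Real.exp_pos ((1 + M) * s))
      linarith
    linarith [hle s hs]
  -- Near `0` the angle lies in `(0, π)`, where the derivatives of the angles differ.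
  set t : ℝ := min L (1 + M)⁻¹ / 2 with ht
  have hmin : 0 < min L (1 + M)⁻¹ := lt_min hL (by positivity)
  have ht0 : 0 < t := by positivity
  have htL : t < L := by linarith [min_le_left L (1 + M)⁻¹]
  have htI : t ∈ Icc 0 L := ⟨ht0.le, htL.le⟩
  have hd : HasDerivAt (fun s => θ₂ s - θ₁ s) 0 t := by
    refine (hasDerivAt_const t (0 : ℝ)).congr_of_eventuallyEq ?_
    filter_upwards [Icc_mem_nhds ht0 htL] with s hs using hzero s hs
  have h6 := hd.unique ((h₂.hasDerivAt t htI).sub (h₁.hasDerivAt t htI))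
  have h7 : θ₂ t = θ₁ t := by linarith [hzero t htI]
  rw [h7, pruferField, pruferField] at h6
  have h8 : (q₂ t - q₁ t) * Real.sin (θ₁ t) ^ 2 = 0 := by linarith
  have h9 : 0 < θ₁ t := h₁.pos hM₁ ⟨ht0, htL.le⟩
  have h10 : θ₁ t ≤ 1 := by
    have h11 := (le_abs_self _).trans (h₁.abs_sub_le hM₁ ⟨le_rfl, hL.le⟩ htI)
    rw [h₁.zero, sub_zero, sub_zero, abs_of_pos ht0] at h11
    have h12 : t ≤ (1 + M)⁻¹ := by linarith [min_le_right L (1 + M)⁻¹]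
    calc θ₁ t ≤ (1 + M) * t := h11
      _ ≤ (1 + M) * (1 + M)⁻¹ := by gcongr
      _ = 1 := mul_inv_cancel₀ (by positivity)
  have h13 : 0 < Real.sin (θ₁ t) :=
    Real.sin_pos_of_pos_of_lt_pi h9 (by linarith [Real.pi_gt_three])
  have h14 : 0 < (q₂ t - q₁ t) * Real.sin (θ₁ t) ^ 2 :=
    mul_pos (by linarith [hq t htI]) (by positivity)
  linarith

end IsPruferAngle

/-! ### Comparison with a constant potential -/

/-- The angle `x + arctan ((k - 1) sin x cos x / (cos² x + k sin² x))`: the increasing function `α`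
of `x` with `tan α = k tan x` that fixes the multiples of `π`. It turns the Prüfer angle into one
that increases at the constant speed `k` when the potential is the constant `k²`. -/
def scaledAngle (k x : ℝ) : ℝ :=
  x + Real.arctan ((k - 1) * (Real.sin x * Real.cos x) / (Real.cos x ^ 2 + k * Real.sin x ^ 2))

lemma cos_sq_add_mul_sin_sq_pos {k : ℝ} (hk : 0 < k) (x : ℝ) :
    0 < Real.cos x ^ 2 + k * Real.sin x ^ 2 := by
  have h := Real.sin_sq_add_cos_sq x
  rcases eq_or_ne (Real.sin x) 0 with h0 | h0
  · rw [h0] at h ⊢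
    nlinarith
  · have : 0 < Real.sin x ^ 2 := by positivity
    positivity

lemma hasDerivAt_scaledAngle {k : ℝ} (hk : 0 < k) (x : ℝ) :
    HasDerivAt (scaledAngle k) (k / pruferField (k ^ 2) x) x := by
  have hD := cos_sq_add_mul_sin_sq_pos hk x
  have hE : 0 < Real.cos x ^ 2 + k ^ 2 * Real.sin x ^ 2 :=
    cos_sq_add_mul_sin_sq_pos (by positivity) x
  have hs := Real.hasDerivAt_sin x
  have hc := Real.hasDerivAt_cos x
  have h1 := ((hs.mul hc).const_mul (k - 1)).div ((hc.pow 2).add ((hs.pow 2).const_mul k)) hD.ne'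
  have h2 := (hasDerivAt_id x).add h1.arctan
  have h3 : HasDerivAt (scaledAngle k) _ x := h2
  convert h3 using 1
  simp only [Pi.mul_apply, Pi.add_apply, Pi.div_apply, Pi.pow_apply, pruferField]
  have hsc := Real.sin_sq_add_cos_sq x
  generalize Real.sin x = S at *
  generalize Real.cos x = C at *
  have hD2 : 0 < (C ^ 2 + k * S ^ 2) ^ 2 + ((k - 1) * (S * C)) ^ 2 := by positivity
  have hDN : (C ^ 2 + k * S ^ 2) ^ 2 + ((k - 1) * (S * C)) ^ 2 = C ^ 2 + k ^ 2 * S ^ 2 := by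
    linear_combination (C ^ 2 + k ^ 2 * S ^ 2) * hsc
  have h4 : 1 + ((k - 1) * (S * C) / (C ^ 2 + k * S ^ 2)) ^ 2
      = (C ^ 2 + k ^ 2 * S ^ 2) / (C ^ 2 + k * S ^ 2) ^ 2 := by
    rw [← hDN]
    field_simp
  rw [h4]
  field_simp
  push_cast
  ring_nf
  have hS : S ^ 2 = 1 - C ^ 2 := by linarith
  have hS4 : S ^ 4 = (1 - C ^ 2) ^ 2 := by rw [← hS]; ring
  simp only [hS, hS4]
  ring

lemma strictMono_scaledAngle {k : ℝ} (hk : 0 < k) : StrictMono (scaledAngle k) := by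
  refine strictMono_of_deriv_pos fun x => ?_
  rw [(hasDerivAt_scaledAngle hk x).deriv]
  exact div_pos hk (cos_sq_add_mul_sin_sq_pos (by positivity) x)

lemma scaledAngle_nat_mul_pi (k : ℝ) (n : ℕ) : scaledAngle k (n * Real.pi) = n * Real.pi := by
  simp [scaledAngle]

namespace IsPruferAngle

variable {q θ : ℝ → ℝ} {L M : ℝ}

lemma hasDerivAt_scaled (hθ : IsPruferAngle q L θ) {k : ℝ} (hk : 0 < k) {s : ℝ}
    (hs : s ∈ Icc 0 L) : HasDerivAt (fun s => scaledAngle k (θ s) - k * s)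
      (k * (pruferField (q s) (θ s) - pruferField (k ^ 2) (θ s)) / pruferField (k ^ 2) (θ s))
      s := by
  have h := ((hasDerivAt_scaledAngle hk (θ s)).comp s (hθ.hasDerivAt s hs)).sub
    ((hasDerivAt_id s).const_mul k)
  have hE : pruferField (k ^ 2) (θ s) ≠ 0 := (cos_sq_add_mul_sin_sq_pos (by positivity) (θ s)).ne'
  refine h.congr_deriv ?_
  rw [mul_sub, sub_div, mul_div_cancel_right₀ _ hE]
  ring

lemma nat_mul_pi_le (hθ : IsPruferAngle q L θ) (hL : 0 < L) {n : ℕ} (hn : 0 < n)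
    (hq : ∀ s ∈ Icc 0 L, (n * Real.pi / L) ^ 2 ≤ q s) : n * Real.pi ≤ θ L := by
  set k : ℝ := n * Real.pi / L with hk
  have hk0 : 0 < k := by positivity
  have hmon := monotoneOn_Icc_of_hasDerivAt (fun s hs => hθ.hasDerivAt_scaled hk0 hs)
    (fun s hs => ?_) ⟨le_rfl, hL.le⟩ ⟨hL.le, le_rfl⟩ hL.le
  · have h1 : k * L = n * Real.pi := div_mul_cancel₀ _ hL.ne'
    have h2 : scaledAngle k 0 = 0 := by simp [scaledAngle]
    simp only [hθ.zero, h1, h2, mul_zero, sub_zero, sub_nonneg] at hmon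
    rw [← scaledAngle_nat_mul_pi k n] at hmon
    exact (strictMono_scaledAngle hk0).le_iff_le.1 hmon
  · refine div_nonneg (mul_nonneg hk0.le ?_) (cos_sq_add_mul_sin_sq_pos (by positivity) _).le
    unfold pruferField
    have := mul_le_mul_of_nonneg_right (hq s hs) (sq_nonneg (Real.sin (θ s)))
    linarith

lemma le_nat_mul_pi (hθ : IsPruferAngle q L θ) (hL : 0 < L) {n : ℕ} (hn : 0 < n)
    (hq : ∀ s ∈ Icc 0 L, q s ≤ (n * Real.pi / L) ^ 2) : θ L ≤ n * Real.pi := by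
  set k : ℝ := n * Real.pi / L with hk
  have hk0 : 0 < k := by positivity
  have hmon := monotoneOn_Icc_of_hasDerivAt (fun s hs => (hθ.hasDerivAt_scaled hk0 hs).neg)
    (fun s hs => ?_) ⟨le_rfl, hL.le⟩ ⟨hL.le, le_rfl⟩ hL.le
  · have h1 : k * L = n * Real.pi := div_mul_cancel₀ _ hL.ne'
    have h2 : scaledAngle k 0 = 0 := by simp [scaledAngle]
    simp only [Pi.neg_apply, hθ.zero, h1, h2, mul_zero, sub_zero, neg_zero, neg_nonneg, sub_nonpos]
      at hmon
    rw [← scaledAngle_nat_mul_pi k n] at hmon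
    exact (strictMono_scaledAngle hk0).le_iff_le.1 hmon
  · rw [neg_nonneg]
    refine div_nonpos_of_nonpos_of_nonneg (mul_nonpos_of_nonneg_of_nonpos hk0.le ?_)
      (cos_sq_add_mul_sin_sq_pos (by positivity) _).le
    unfold pruferField
    have := mul_le_mul_of_nonneg_right (hq s hs) (sq_nonneg (Real.sin (θ s)))
    linarith

/-! ### Zeros and the Prüfer angle -/

/-- If the Prüfer angle reaches `n π` at `L`, it passes exactly once through each of
`0, π, …, n π`, at points `0 = z₀ < … < zₙ = L`, and through no other multiple of `π`. -/
lemma exists_nodes (hθ : IsPruferAngle q L θ) (hL : 0 < L) (hM : ∀ s ∈ Icc 0 L, |q s| ≤ M)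
    {n : ℕ} (hn : θ L = n * Real.pi) :
    ∃ z : Fin (n + 1) → ℝ, StrictMono z ∧ z 0 = 0 ∧ z (Fin.last n) = L ∧
      (∀ k, z k ∈ Icc 0 L ∧ θ (z k) = (k : ℕ) * Real.pi) ∧
      ∀ s ∈ Icc 0 L, ∀ m : ℤ, θ s = m * Real.pi → s ∈ range z := by
  have hM0 : 0 ≤ M := (abs_nonneg _).trans (hM 0 ⟨le_rfl, hL.le⟩)
  have hc : 0 < (2 + (1 + M) * L ^ 2)⁻¹ := by positivity
  have hmono : ∀ a ∈ Icc 0 L, ∀ b ∈ Icc 0 L, ∀ m : ℤ, θ a = m * Real.pi → a < b →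
      θ a < θ b := by
    intro a ha b hb m hm hab
    have h := hθ.le_of_eq_left hM ha.1 hab.le hb.2 hm
    have := mul_pos hc (sub_pos.2 hab)
    linarith
  have hinj : ∀ a ∈ Icc 0 L, ∀ b ∈ Icc 0 L, ∀ m : ℤ, θ a = m * Real.pi → θ b = m * Real.pi →
      a = b := by
    intro a ha b hb m hma hmb
    by_contra hne
    rcases lt_or_gt_of_ne hne with h | h
    · have := hmono a ha b hb m hma h
      linarith
    · have := hmono b hb a ha m hmb h
      linarith
  have hex : ∀ k : Fin (n + 1), ∃ s ∈ Icc 0 L, θ s = (k : ℕ) * Real.pi := by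
    intro k
    have h1 := intermediate_value_Icc hL.le hθ.continuousOn
    have h2 : ((k : ℕ) : ℝ) * Real.pi ∈ Icc (θ 0) (θ L) := by
      rw [hθ.zero, hn]
      have h3 : ((k : ℕ) : ℝ) ≤ n := by exact_mod_cast Nat.lt_succ_iff.1 k.2
      exact ⟨by positivity, by gcongr⟩
    exact h1 h2
  choose z hz hθz using hex
  have hθz' : ∀ k : Fin (n + 1), θ (z k) = ((k : ℕ) : ℤ) * Real.pi := fun k => by
    rw [hθz]
    simp
  refine ⟨z, fun j k hjk => ?_, ?_, ?_, fun k => ⟨hz k, hθz k⟩, fun s hs m hm => ?_⟩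
  · by_contra! hle
    have hjk' : ((j : ℕ) : ℝ) < (k : ℕ) := by exact_mod_cast hjk
    have h1 : θ (z j) < θ (z k) := by
      rw [hθz, hθz]
      exact mul_lt_mul_of_pos_right hjk' Real.pi_pos
    rcases hle.eq_or_lt with h | h
    · rw [h] at h1
      exact lt_irrefl _ h1
    · have := hmono _ (hz k) _ (hz j) k (by exact_mod_cast hθz' k) h
      linarith
  · exact hinj _ (hz 0) _ ⟨le_rfl, hL.le⟩ 0 (by simp [hθz]) (by simp [hθ.zero])
  · exact hinj _ (hz _) _ ⟨hL.le, le_rfl⟩ n (by simp [hθz]) (by simp [hn])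
  · have hm0 : 0 ≤ m := by
      have h1 : 0 ≤ θ s := by
        rcases hs.1.eq_or_lt with h | h
        · rw [← h, hθ.zero]
        · exact (hθ.pos hM ⟨h, hs.2⟩).le
      rw [hm] at h1
      have := nonneg_of_mul_nonneg_left h1 Real.pi_pos
      exact_mod_cast this
    have hmn : m ≤ n := by
      have h1 : θ s ≤ θ L := by
        rcases hs.2.eq_or_lt with h | h
        · rw [h]
        · exact (hmono s hs L ⟨hL.le, le_rfl⟩ m hm h).le
      rw [hm, hn] at h1
      have := le_of_mul_le_mul_right h1 Real.pi_pos
      exact_mod_cast this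
    lift m to ℕ using hm0
    have hmn' : m < n + 1 := by omega
    exact ⟨⟨m, hmn'⟩, hinj _ (hz _) s hs m (by simp [hθz]) hm⟩

lemma abs_sin_eq_of_add_int_mul_pi (x : ℝ) (m : ℤ) :
    |Real.sin (x + m * Real.pi)| = |Real.sin x| := by
  rw [Real.sin_add_int_mul_pi, abs_mul, abs_zpow]
  simp

/-- Between two consecutive zeros, `|sin θ|` is at least a constant times the distance to the
zeros. -/
lemma mul_min_le_abs_sin (hθ : IsPruferAngle q L θ) (hM : ∀ s ∈ Icc 0 L, |q s| ≤ M)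
    {a b s : ℝ} (ha : 0 ≤ a) (hb : b ≤ L) (hs : s ∈ Icc a b) {m : ℕ} (hma : θ a = m * Real.pi)
    (hmb : θ b = (m + 1 : ℕ) * Real.pi) :
    2 / Real.pi * ((2 + (1 + M) * L ^ 2)⁻¹ * min (s - a) (b - s)) ≤ |Real.sin (θ s)| := by
  have hM0 : 0 ≤ M := (abs_nonneg _).trans (hM s ⟨ha.trans hs.1, hs.2.trans hb⟩)
  have h1 := hθ.le_of_eq_left hM ha hs.1 (hs.2.trans hb) (m := m) (by exact_mod_cast hma)
  have h2 := hθ.le_of_eq_right hM (ha.trans hs.1) hs.2 hb (m := (m + 1 : ℕ))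
    (by exact_mod_cast hmb)
  set c := (2 + (1 + M) * L ^ 2)⁻¹ with hc
  have hc0 : 0 < c := by positivity
  push_cast at h1 h2
  set x := θ s - m * Real.pi with hx
  have hsin : |Real.sin (θ s)| = |Real.sin x| := by
    have h := abs_sin_eq_of_add_int_mul_pi x m
    rw [← h]
    congr 2
    rw [hx]
    push_cast
    ring
  have h3 : c * min (s - a) (b - s) ≤ c * (s - a) := by
    gcongr
    exact min_le_left _ _
  have h4 : c * min (s - a) (b - s) ≤ c * (b - s) := by
    gcongr
    exact min_le_right _ _
  have h0 : 0 ≤ c * min (s - a) (b - s) :=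
    mul_nonneg hc0.le (le_min (by linarith [hs.1]) (by linarith [hs.2]))
  rw [hsin]
  have hpi : 0 ≤ 2 / Real.pi := by positivity
  rcases le_total x (Real.pi / 2) with h | h
  · calc 2 / Real.pi * (c * min (s - a) (b - s)) ≤ 2 / Real.pi * x := by
          gcongr
          linarith
      _ ≤ Real.sin x := Real.mul_le_sin (by linarith) h
      _ ≤ |Real.sin x| := le_abs_self _
  · calc 2 / Real.pi * (c * min (s - a) (b - s)) ≤ 2 / Real.pi * (Real.pi - x) := by
          gcongr
          linarith
      _ ≤ Real.sin (Real.pi - x) := Real.mul_le_sin (by linarith) (by linarith)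
      _ = Real.sin x := Real.sin_pi_sub x
      _ ≤ |Real.sin x| := le_abs_self _

end IsPruferAngle

/-! ### Classical solutions -/

/-- `u` solves `u'' + q u = 0` on `[0, L]` and `u'` is its derivative. The derivatives are
two-sided also at the end points. -/
structure IsSolution (q : ℝ → ℝ) (L : ℝ) (u u' : ℝ → ℝ) : Prop where
  hasDerivAt : ∀ s ∈ Icc 0 L, HasDerivAt u (u' s) s
  hasDerivAt_deriv : ∀ s ∈ Icc 0 L, HasDerivAt u' (-(q s * u s)) s

/-- The Prüfer angle yields a solution `u = r sin θ`, `u' = r cos θ`, with an amplitude `r` that is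
the exponential of an integral. -/
theorem IsPruferAngle.exists_isSolution {q θ : ℝ → ℝ} {L : ℝ} (hθ : IsPruferAngle q L θ)
    (hq : Continuous q) (hL : 0 < L) :
    ∃ r : ℝ → ℝ, r 0 = 1 ∧ (∀ s, 0 < r s) ∧
      IsSolution q L (fun s => r s * Real.sin (θ s)) (fun s => r s * Real.cos (θ s)) := by
  let η : ℝ → ℝ := IccExtend hL.le ((Icc 0 L).domRestrict θ)
  have hη : Continuous η := (continuousOn_iff_continuous_domRestrict.1 hθ.continuousOn).Icc_extend'
  have hηθ : ∀ s ∈ Icc 0 L, η s = θ s := fun s hs => IccExtend_of_mem hL.le _ hs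
  let g : ℝ → ℝ := fun s => (1 - q s) * Real.sin (η s) * Real.cos (η s)
  have hg : Continuous g := by fun_prop
  let r : ℝ → ℝ := fun s => Real.exp (∫ x in (0 : ℝ)..s, g x)
  have hr : ∀ s ∈ Icc 0 L,
      HasDerivAt r (r s * ((1 - q s) * Real.sin (θ s) * Real.cos (θ s))) s := by
    intro s hs
    have h := (hg.integral_hasStrictDerivAt 0 s).hasDerivAt.exp
    rw [← hηθ s hs]
    exact h
  refine ⟨r, by simp [r], fun s => Real.exp_pos _, fun s hs => ?_, fun s hs => ?_⟩
  · refine ((hr s hs).mul (hθ.hasDerivAt s hs).sin).congr_deriv ?_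
    unfold pruferField
    linear_combination (r s * Real.cos (θ s)) * Real.sin_sq_add_cos_sq (θ s)
  · refine ((hr s hs).mul (hθ.hasDerivAt s hs).cos).congr_deriv ?_
    unfold pruferField
    linear_combination (-(r s * q s * Real.sin (θ s))) * Real.sin_sq_add_cos_sq (θ s)

lemma intervalIntegrable_of_continuousOn {f : ℝ → ℝ} (hL : 0 < L)
    (hf : ContinuousOn f (Icc 0 L)) : IntervalIntegrable f volume 0 L :=
  ContinuousOn.intervalIntegrable (by rwa [uIcc_of_le hL.le])

namespace IsSolution

variable {q u u' : ℝ → ℝ} {L M : ℝ}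

lemma continuousOn (hu : IsSolution q L u u') : ContinuousOn u (Icc 0 L) :=
  fun s hs => (hu.hasDerivAt s hs).continuousAt.continuousWithinAt

lemma continuousOn_deriv (hu : IsSolution q L u u') : ContinuousOn u' (Icc 0 L) :=
  fun s hs => (hu.hasDerivAt_deriv s hs).continuousAt.continuousWithinAt

lemma const_mul (hu : IsSolution q L u u') (c : ℝ) :
    IsSolution q L (fun s => c * u s) (fun s => c * u' s) where
  hasDerivAt s hs := (hu.hasDerivAt s hs).const_mul c
  hasDerivAt_deriv s hs := by
    refine ((hu.hasDerivAt_deriv s hs).const_mul c).congr_deriv ?_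
    ring

lemma sub {w w' : ℝ → ℝ} (hu : IsSolution q L u u') (hw : IsSolution q L w w') :
    IsSolution q L (fun s => u s - w s) (fun s => u' s - w' s) where
  hasDerivAt s hs := (hu.hasDerivAt s hs).sub (hw.hasDerivAt s hs)
  hasDerivAt_deriv s hs := by
    refine ((hu.hasDerivAt_deriv s hs).sub (hw.hasDerivAt_deriv s hs)).congr_deriv ?_
    ring

lemma hasDerivAt_energy (hu : IsSolution q L u u') {s : ℝ} (hs : s ∈ Icc 0 L) :
    HasDerivAt (fun s => u s ^ 2 + u' s ^ 2) (2 * (1 - q s) * (u s * u' s)) s := by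
  refine (((hu.hasDerivAt s hs).pow 2).add ((hu.hasDerivAt_deriv s hs).pow 2)).congr_deriv ?_
  push_cast
  ring

lemma abs_energy_deriv_le {q M : ℝ} (hq : |q| ≤ M) (x y : ℝ) :
    |2 * (1 - q) * (x * y)| ≤ (1 + M) * (x ^ 2 + y ^ 2) := by
  have h1 : |1 - q| ≤ 1 + M := by
    have h := abs_le.1 hq
    rw [abs_le]
    constructor <;> linarith
  have h2 : |2 * (x * y)| ≤ x ^ 2 + y ^ 2 := by
    rw [abs_le]
    constructor <;> nlinarith [sq_nonneg (x + y), sq_nonneg (x - y)]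
  calc |2 * (1 - q) * (x * y)| = |1 - q| * |2 * (x * y)| := by
        rw [← abs_mul]
        congr 1
        ring
    _ ≤ (1 + M) * (x ^ 2 + y ^ 2) :=
        mul_le_mul h1 h2 (abs_nonneg _) ((abs_nonneg _).trans h1)

/-- The energy `u² + u'²` of a solution at two points is comparable, by Grönwall's inequality. -/
lemma energy_le (hu : IsSolution q L u u') (hM : ∀ s ∈ Icc 0 L, |q s| ≤ M) {s t : ℝ}
    (hs : s ∈ Icc 0 L) (ht : t ∈ Icc 0 L) :
    u s ^ 2 + u' s ^ 2 ≤ Real.exp ((1 + M) * L) * (u t ^ 2 + u' t ^ 2) := by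
  have hM0 : 0 ≤ M := (abs_nonneg _).trans (hM s hs)
  have key : ∀ σ : ℝ, σ ^ 2 = 1 → MonotoneOn
      (fun s => σ * ((u s ^ 2 + u' s ^ 2) * Real.exp (σ * (1 + M) * s))) (Icc 0 L) := by
    intro σ hσ
    refine monotoneOn_Icc_of_hasDerivAt (f' := fun s => σ *
      ((2 * (1 - q s) * (u s * u' s)) * Real.exp (σ * (1 + M) * s) + (u s ^ 2 + u' s ^ 2)
        * (Real.exp (σ * (1 + M) * s) * (σ * (1 + M))))) (fun s hs => ?_) (fun s hs => ?_)
    · have h := ((hasDerivAt_id s).const_mul (σ * (1 + M))).exp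
      have h' := ((hu.hasDerivAt_energy hs).mul h).const_mul σ
      simpa using! h'
    · have h1 := abs_le.1 (abs_energy_deriv_le (hM s hs) (u s) (u' s))
      have h2 : 0 ≤ (σ * (2 * (1 - q s) * (u s * u' s)) + (1 + M) * (u s ^ 2 + u' s ^ 2))
          * Real.exp (σ * (1 + M) * s) := by
        apply mul_nonneg _ (Real.exp_pos _).le
        rcases eq_or_eq_neg_of_sq_eq_sq σ 1 (by rw [hσ, one_pow]) with h | h <;> rw [h] <;> linarith
      have h3 : σ * ((2 * (1 - q s) * (u s * u' s)) * Real.exp (σ * (1 + M) * s)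
          + (u s ^ 2 + u' s ^ 2) * (Real.exp (σ * (1 + M) * s) * (σ * (1 + M))))
          = (σ * (2 * (1 - q s) * (u s * u' s)) + σ ^ 2 * (1 + M) * (u s ^ 2 + u' s ^ 2))
          * Real.exp (σ * (1 + M) * s) := by ring
      rw [h3, hσ, one_mul]
      exact h2
  have hE : ∀ x, 0 ≤ u x ^ 2 + u' x ^ 2 := fun x => by positivity
  rcases le_total s t with hst | hst
  · have h := key 1 (by norm_num) hs ht hst
    simp only [one_mul] at h
    have h1 : 1 ≤ Real.exp ((1 + M) * s) := Real.one_le_exp (mul_nonneg (by linarith) hs.1)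
    have h2 : Real.exp ((1 + M) * t) ≤ Real.exp ((1 + M) * L) := by
      gcongr
      exact ht.2
    calc u s ^ 2 + u' s ^ 2 ≤ (u s ^ 2 + u' s ^ 2) * Real.exp ((1 + M) * s) :=
          le_mul_of_one_le_right (hE s) h1
      _ ≤ (u t ^ 2 + u' t ^ 2) * Real.exp ((1 + M) * t) := h
      _ ≤ (u t ^ 2 + u' t ^ 2) * Real.exp ((1 + M) * L) := by gcongr
      _ = _ := mul_comm _ _
  · have h := key (-1) (by norm_num) ht hs hst
    simp only [neg_mul, one_mul, neg_le_neg_iff] at h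
    rw [Real.exp_neg, Real.exp_neg, ← div_eq_mul_inv, ← div_eq_mul_inv,
      div_le_div_iff₀ (Real.exp_pos _) (Real.exp_pos _)] at h
    have h1 : 1 ≤ Real.exp ((1 + M) * t) := Real.one_le_exp (mul_nonneg (by linarith) ht.1)
    have h2 : Real.exp ((1 + M) * s) ≤ Real.exp ((1 + M) * L) := by
      gcongr
      exact hs.2
    calc u s ^ 2 + u' s ^ 2 ≤ (u s ^ 2 + u' s ^ 2) * Real.exp ((1 + M) * t) :=
          le_mul_of_one_le_right (hE s) h1
      _ ≤ (u t ^ 2 + u' t ^ 2) * Real.exp ((1 + M) * s) := h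
      _ ≤ (u t ^ 2 + u' t ^ 2) * Real.exp ((1 + M) * L) := by gcongr
      _ = _ := mul_comm _ _

/-- A solution that vanishes at `0` is a multiple of the one with initial data `(0, 1)`. -/
lemma eq_mul {w w' : ℝ → ℝ} (hw : IsSolution q L w w') (hu : IsSolution q L u u')
    (hM : ∀ s ∈ Icc 0 L, |q s| ≤ M) (hL : 0 < L) (hw0 : w 0 = 0) (hu0 : u 0 = 0)
    (hu'0 : u' 0 = 1) : ∀ s ∈ Icc 0 L, w s = w' 0 * u s := by
  intro s hs
  have h := (hw.sub (hu.const_mul (w' 0))).energy_le hM hs (t := 0) ⟨le_rfl, hL.le⟩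
  simp only [hw0, hu0, hu'0, mul_zero, mul_one, sub_self] at h
  have h1 : (w s - w' 0 * u s) ^ 2 = 0 := by
    apply le_antisymm _ (sq_nonneg _)
    nlinarith [sq_nonneg (w' s - w' 0 * u' s)]
  exact sub_eq_zero.1 (pow_eq_zero_iff two_ne_zero |>.1 h1)

lemma derivWithin_eq (hu : IsSolution q L u u') (hL : 0 < L) :
    EqOn (derivWithin u (Icc 0 L)) u' (Icc 0 L) := fun s hs =>
  (hu.hasDerivAt s hs).hasDerivWithinAt.derivWithin (uniqueDiffOn_Icc hL s hs)

lemma derivWithin_deriv_eq (hu : IsSolution q L u u') (hL : 0 < L) :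
    EqOn (derivWithin u' (Icc 0 L)) (fun s => -(q s * u s)) (Icc 0 L) := fun s hs =>
  (hu.hasDerivAt_deriv s hs).hasDerivWithinAt.derivWithin (uniqueDiffOn_Icc hL s hs)

/-- Solutions are smooth up to the boundary when the potential is. -/
lemma contDiffOn (hu : IsSolution q L u u') (hL : 0 < L) (hq : ContDiffOn ℝ ∞ q (Icc 0 L)) :
    ContDiffOn ℝ ∞ u (Icc 0 L) := by
  have hU := uniqueDiffOn_Icc hL
  have key : ∀ n : ℕ, ContDiffOn ℝ n u (Icc 0 L) ∧ ContDiffOn ℝ n u' (Icc 0 L) := by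
    intro n
    induction n with
    | zero => exact ⟨contDiffOn_zero.2 hu.continuousOn, contDiffOn_zero.2 hu.continuousOn_deriv⟩
    | succ n ih =>
      constructor
      · push_cast
        rw [contDiffOn_succ_iff_derivWithin hU]
        refine ⟨fun s hs => (hu.hasDerivAt s hs).differentiableAt.differentiableWithinAt,
          fun h => by simp at h, ih.2.congr (hu.derivWithin_eq hL)⟩
      · push_cast
        rw [contDiffOn_succ_iff_derivWithin hU]
        refine ⟨fun s hs => (hu.hasDerivAt_deriv s hs).differentiableAt.differentiableWithinAt,
          fun h => by simp at h, ?_⟩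
        exact (((hq.of_le (by exact_mod_cast le_top)).mul ih.1).neg).congr
          (hu.derivWithin_deriv_eq hL)
  exact contDiffOn_infty.2 fun n => (key n).1

lemma C2Norm_le (hu : IsSolution q L u u') (hM : ∀ s ∈ Icc 0 L, |q s| ≤ M) (hL : 0 < L) {B : ℝ}
    (hB : ∀ s ∈ Icc 0 L, |u s| ≤ B ∧ |u' s| ≤ B) : C2Norm L u ≤ (2 + M) * B := by
  have h0 : (0 : ℝ) ∈ Icc 0 L := ⟨le_rfl, hL.le⟩
  have : Nonempty (Icc 0 L) := ⟨⟨0, h0⟩⟩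
  have h1 : EqOn (iteratedDerivWithin 1 u (Icc 0 L)) u' (Icc 0 L) := fun s hs => by
    rw [iteratedDerivWithin_one]
    exact hu.derivWithin_eq hL hs
  have h2 : EqOn (iteratedDerivWithin 2 u (Icc 0 L)) (fun s => -(q s * u s)) (Icc 0 L) :=
    fun s hs => by
      rw [iteratedDerivWithin_succ, derivWithin_congr h1 (h1 hs)]
      exact hu.derivWithin_deriv_eq hL hs
  unfold C2Norm
  rw [Finset.sum_range_succ, Finset.sum_range_succ, Finset.sum_range_one]
  have e0 : ⨆ s : Icc 0 L, |iteratedDerivWithin 0 u (Icc 0 L) s| ≤ B :=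
    ciSup_le fun s => by simpa using (hB s s.2).1
  have e1 : ⨆ s : Icc 0 L, |iteratedDerivWithin 1 u (Icc 0 L) s| ≤ B :=
    ciSup_le fun s => by
      rw [h1 s.2]
      exact (hB s s.2).2
  have e2 : ⨆ s : Icc 0 L, |iteratedDerivWithin 2 u (Icc 0 L) s| ≤ M * B :=
    ciSup_le fun s => by
      rw [h2 s.2, abs_neg, abs_mul]
      exact mul_le_mul (hM s s.2) (hB s s.2).1 (abs_nonneg _) ((abs_nonneg _).trans (hM s s.2))
  linarith

/-- The energy identity `∫ u'² = ∫ q u²`, as a bound on the total energy. -/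
lemma integral_energy_le (hu : IsSolution q L u u') (hq : Continuous q)
    (hM : ∀ s ∈ Icc 0 L, |q s| ≤ M) (hL : 0 < L)
    (h0 : u 0 = 0) (huL : u L = 0) :
    ∫ s in (0 : ℝ)..L, (u s ^ 2 + u' s ^ 2) ≤ (1 + M) * ∫ s in (0 : ℝ)..L, u s ^ 2 := by
  have hc := hu.continuousOn
  have hc' := hu.continuousOn_deriv
  have hqc : ContinuousOn q (Icc 0 L) := hq.continuousOn
  have h3 : IntervalIntegrable (fun s => u' s ^ 2 - q s * u s ^ 2) volume 0 L :=
    intervalIntegrable_of_continuousOn hL (by fun_prop)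
  have h1 : ∫ s in (0 : ℝ)..L, (u' s ^ 2 - q s * u s ^ 2) = u L * u' L - u 0 * u' 0 := by
    refine intervalIntegral.integral_eq_sub_of_hasDerivAt (f := fun s => u s * u' s)
      (fun s hs => ?_) h3
    rw [uIcc_of_le hL.le] at hs
    refine ((hu.hasDerivAt s hs).mul (hu.hasDerivAt_deriv s hs)).congr_deriv ?_
    ring
  rw [h0, huL, zero_mul, zero_mul, sub_zero] at h1
  have h2 : IntervalIntegrable (fun s => (1 + M) * u s ^ 2) volume 0 L :=
    intervalIntegrable_of_continuousOn hL (by fun_prop)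
  have h4 := intervalIntegral.integral_add h2 h3
  rw [h1, add_zero, intervalIntegral.integral_const_mul] at h4
  rw [← h4]
  refine intervalIntegral.integral_mono_on hL.le
    (intervalIntegrable_of_continuousOn hL (by fun_prop)) (h2.add h3) fun s hs => ?_
  have := mul_le_mul_of_nonneg_right (abs_le.1 (hM s hs)).2 (sq_nonneg (u s))
  linarith

/-- Pointwise two-sided bounds on the energy of a normalized Dirichlet solution. -/
lemma energy_bounds (hu : IsSolution q L u u') (hq : Continuous q)
    (hM : ∀ s ∈ Icc 0 L, |q s| ≤ M) (hL : 0 < L) (h0 : u 0 = 0) (huL : u L = 0)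
    (hnorm : ∫ s in (0 : ℝ)..L, u s ^ 2 = 1) {s : ℝ} (hs : s ∈ Icc 0 L) :
    (L * Real.exp ((1 + M) * L))⁻¹ ≤ u s ^ 2 + u' s ^ 2 ∧
      u s ^ 2 + u' s ^ 2 ≤ Real.exp ((1 + M) * L) * (1 + M) / L := by
  have hc := hu.continuousOn
  have hc' := hu.continuousOn_deriv
  have hI : IntervalIntegrable (fun s => u s ^ 2 + u' s ^ 2) volume 0 L :=
    intervalIntegrable_of_continuousOn hL (by fun_prop)
  have hX := Real.exp_pos ((1 + M) * L)
  set X := Real.exp ((1 + M) * L) with hXdef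
  have h1 := hu.integral_energy_le hq hM hL h0 huL
  rw [hnorm, mul_one] at h1
  constructor
  · have h2 : ∫ t in (0 : ℝ)..L, u t ^ 2 ≤ ∫ _t in (0 : ℝ)..L, X * (u s ^ 2 + u' s ^ 2) :=
      intervalIntegral.integral_mono_on hL.le
        (intervalIntegrable_of_continuousOn hL (by fun_prop))
        (intervalIntegrable_of_continuousOn hL (by fun_prop)) fun t ht => by
          have := hu.energy_le hM ht hs
          linarith [sq_nonneg (u' t)]
    rw [hnorm, intervalIntegral.integral_const, sub_zero, smul_eq_mul] at h2
    rw [inv_le_iff_one_le_mul₀ (by positivity)]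
    linarith
  · have h2 : ∫ _t in (0 : ℝ)..L, (u s ^ 2 + u' s ^ 2)
        ≤ ∫ t in (0 : ℝ)..L, X * (u t ^ 2 + u' t ^ 2) :=
      intervalIntegral.integral_mono_on hL.le
        (intervalIntegrable_of_continuousOn hL (by fun_prop))
        (intervalIntegrable_of_continuousOn hL (by fun_prop)) fun t ht => hu.energy_le hM hs ht
    rw [intervalIntegral.integral_const, sub_zero, smul_eq_mul,
      intervalIntegral.integral_const_mul] at h2
    rw [le_div_iff₀ hL]
    have h3 := mul_le_mul_of_nonneg_left h1 hX.le
    linarith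

end IsSolution

/-! ### The space `L²(0, L)` and test functions -/

lemma intervalIntegral_eq_setIntegral_Ioo {L : ℝ} (hL : 0 < L) (f : ℝ → ℝ) :
    ∫ s in (0 : ℝ)..L, f s = ∫ s in Ioo 0 L, f s := by
  rw [intervalIntegral.integral_of_le hL.le, integral_Ioc_eq_integral_Ioo]

lemma inner_eq_setIntegral {L : ℝ} {f g : L2 L} {F G : ℝ → ℝ}
    (hf : (f : ℝ → ℝ) =ᵐ[volume.restrict (Ioo 0 L)] F)
    (hg : (g : ℝ → ℝ) =ᵐ[volume.restrict (Ioo 0 L)] G) :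
    inner ℝ f g = ∫ s in Ioo 0 L, F s * G s := by
  rw [L2.inner_def]
  refine integral_congr_ae ?_
  filter_upwards [hf, hg] with s h1 h2
  rw [h1, h2]
  exact mul_comm _ _

lemma memLp_of_continuousOn {L : ℝ} {F : ℝ → ℝ} (hF : ContinuousOn F (Icc 0 L)) :
    MemLp F 2 (volume.restrict (Ioo 0 L)) := by
  obtain ⟨B, hB⟩ := isCompact_Icc.exists_bound_of_continuousOn hF
  refine MemLp.of_bound ((hF.mono Ioo_subset_Icc_self).aestronglyMeasurable measurableSet_Ioo) B ?_
  filter_upwards [ae_restrict_mem measurableSet_Ioo] with s hs using hB s (Ioo_subset_Icc_self hs)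

lemma exists_ae_eq_of_continuousOn {L : ℝ} {F : ℝ → ℝ} (hF : ContinuousOn F (Icc 0 L)) :
    ∃ f : L2 L, (f : ℝ → ℝ) =ᵐ[volume.restrict (Ioo 0 L)] F :=
  ⟨(memLp_of_continuousOn hF).toLp F, (memLp_of_continuousOn hF).coeFn_toLp⟩

lemma integrableOn_L2 {L : ℝ} (f : L2 L) : IntegrableOn f (Ioo 0 L) :=
  (Lp.memLp f).integrable (by norm_num)

lemma integrableOn_L2_mul {L : ℝ} (f : L2 L) {F : ℝ → ℝ} (hF : ContinuousOn F (Icc 0 L)) :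
    IntegrableOn (fun s => f s * F s) (Ioo 0 L) :=
  (Lp.memLp f).integrable_mul (memLp_of_continuousOn hF)

/-- The functions `ψ ∈ C_c^∞(0, L)`, extended by zero. -/
structure IsTestFunction (L : ℝ) (ψ : ℝ → ℝ) : Prop where
  contDiff : ContDiff ℝ ∞ ψ
  hasCompactSupport : HasCompactSupport ψ
  tsupport_subset : tsupport ψ ⊆ Ioo 0 L

namespace IsTestFunction

variable {L : ℝ} {ψ : ℝ → ℝ}

lemma continuous (h : IsTestFunction L ψ) : Continuous ψ := h.contDiff.continuous

lemma continuous_deriv (h : IsTestFunction L ψ) : Continuous (deriv ψ) :=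
  (contDiff_infty_iff_deriv.1 h.contDiff).2.continuous

lemma hasDerivAt (h : IsTestFunction L ψ) (s : ℝ) : HasDerivAt ψ (deriv ψ s) s :=
  ((contDiff_infty_iff_deriv.1 h.contDiff).1 s).hasDerivAt

lemma eq_zero_of_notMem (h : IsTestFunction L ψ) {s : ℝ} (hs : s ∉ Ioo 0 L) : ψ s = 0 :=
  image_eq_zero_of_notMem_tsupport fun h' => hs (h.tsupport_subset h')

lemma apply_zero (h : IsTestFunction L ψ) : ψ 0 = 0 :=
  h.eq_zero_of_notMem (by simp)

lemma apply_right (h : IsTestFunction L ψ) : ψ L = 0 :=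
  h.eq_zero_of_notMem (by simp)

/-- A test function lives on a compact subinterval. -/
lemma exists_Icc (h : IsTestFunction L ψ) (hL : 0 < L) :
    ∃ a b, 0 < a ∧ b < L ∧ ∀ s, s ∉ Icc a b → ψ s = 0 := by
  rcases (tsupport ψ).eq_empty_or_nonempty with h0 | h0
  · exact ⟨L, 0, hL, hL, fun s _ => image_eq_zero_of_notMem_tsupport (by simp [h0])⟩
  · have hc : IsCompact (tsupport ψ) := h.hasCompactSupport
    refine ⟨sInf (tsupport ψ), sSup (tsupport ψ), (h.tsupport_subset (hc.sInf_mem h0)).1,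
      (h.tsupport_subset (hc.sSup_mem h0)).2, fun s hs => ?_⟩
    refine image_eq_zero_of_notMem_tsupport fun h' => hs ?_
    exact ⟨csInf_le hc.bddBelow h', le_csSup hc.bddAbove h'⟩

/-- A linear combination of test functions with integral zero has a primitive that is a test
function. -/
lemma exists_primitive {η ρ : ℝ → ℝ} (hη : IsTestFunction L η) (hρ : IsTestFunction L ρ)
    (hL : 0 < L) {m : ℝ} (h0 : ∫ s in (0 : ℝ)..L, (η s - m * ρ s) = 0) :
    ∃ ψ, IsTestFunction L ψ ∧ deriv ψ = fun s => η s - m * ρ s := by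
  obtain ⟨a, b, ha, hb, hab⟩ := hη.exists_Icc hL
  obtain ⟨a', b', ha', hb', hab'⟩ := hρ.exists_Icc hL
  set χ : ℝ → ℝ := fun s => η s - m * ρ s with hχ
  have hχc : ContDiff ℝ ∞ χ := hη.contDiff.sub (contDiff_const.mul hρ.contDiff)
  have hχ0 : ∀ s, s ∉ Icc (min a a') (max b b') → χ s = 0 := by
    intro s hs
    have h1 : η s = 0 := hab s fun h => hs ⟨min_le_of_left_le h.1, le_max_of_le_left h.2⟩
    have h2 : ρ s = 0 := hab' s fun h => hs ⟨min_le_of_right_le h.1, le_max_of_le_right h.2⟩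
    simp [hχ, h1, h2]
  have ha0 : 0 < min a a' := lt_min ha ha'
  have hbL : max b b' < L := max_lt hb hb'
  have hd : ∀ s, HasDerivAt (fun s => ∫ x in (0 : ℝ)..s, χ x) (χ s) s := fun s =>
    (hχc.continuous.integral_hasStrictDerivAt 0 s).hasDerivAt
  have hderiv : deriv (fun s => ∫ x in (0 : ℝ)..s, χ x) = χ := funext fun s => (hd s).deriv
  have hzero : ∀ s, s ∉ Icc (min a a') (max b b') → ∫ x in (0 : ℝ)..s, χ x = 0 := by
    intro s hs
    rcases lt_or_ge s (min a a') with h | h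
    · refine intervalIntegral.integral_zero_ae (ae_of_all _ fun x hx => hχ0 x fun h' => ?_)
      have : x ≤ max 0 s := hx.2
      exact absurd h'.1 (not_le.2 (this.trans_lt (max_lt ha0 h)))
    · have h' : max b b' < s := by
        by_contra! h'
        exact hs ⟨h, h'⟩
      have hI := fun u v => hχc.continuous.intervalIntegrable (μ := volume) u v
      rw [← intervalIntegral.integral_add_adjacent_intervals (hI 0 L) (hI L s), h0, zero_add]
      refine intervalIntegral.integral_zero_ae (ae_of_all _ fun x hx => hχ0 x fun hx' => ?_)
      have : min L s < x := hx.1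
      exact absurd hx'.2 (not_le.2 ((lt_min hbL h').trans this))
  have hsub : tsupport (fun s => ∫ x in (0 : ℝ)..s, χ x) ⊆ Icc (min a a') (max b b') := by
    refine closure_minimal (fun s hs => ?_) isClosed_Icc
    by_contra h
    exact hs (hzero s h)
  refine ⟨fun s => ∫ x in (0 : ℝ)..s, χ x, ⟨?_, HasCompactSupport.intro isCompact_Icc hzero, ?_⟩,
    hderiv⟩
  · rw [contDiff_infty_iff_deriv, hderiv]
    exact ⟨fun s => (hd s).differentiableAt, hχc⟩
  · exact hsub.trans fun s hs => ⟨ha0.trans_le hs.1, hs.2.trans_lt hbL⟩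

lemma exists_integral_eq_one (hL : 0 < L) :
    ∃ ρ, IsTestFunction L ρ ∧ ∫ s in (0 : ℝ)..L, ρ s = 1 := by
  let B : ContDiffBump (L / 2) := ⟨L / 8, L / 4, by linarith, by linarith⟩
  have hsub : tsupport (B.normed volume) ⊆ Ioo 0 L := by
    rw [B.tsupport_normed_eq, Real.closedBall_eq_Icc]
    intro s hs
    have h1 : L / 2 - L / 4 ≤ s := hs.1
    have h2 : s ≤ L / 2 + L / 4 := hs.2
    exact ⟨by linarith, by linarith⟩
  refine ⟨B.normed volume, ⟨B.contDiff_normed, B.hasCompactSupport_normed, hsub⟩, ?_⟩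
  rw [intervalIntegral_eq_setIntegral_Ioo hL, setIntegral_eq_integral_of_forall_compl_eq_zero,
    B.integral_normed]
  exact fun s hs => image_eq_zero_of_notMem_tsupport fun h => hs (hsub h)

end IsTestFunction

/-- The lemma of du Bois-Reymond: a function that is orthogonal to all derivatives of test
functions is constant. -/
theorem exists_ae_eq_const {L : ℝ} (hL : 0 < L) {g : ℝ → ℝ} (hg : IntegrableOn g (Ioo 0 L))
    (hgc : ∀ F : ℝ → ℝ, Continuous F → IntegrableOn (fun s => g s * F s) (Ioo 0 L))
    (h : ∀ ψ, IsTestFunction L ψ → ∫ s in Ioo 0 L, g s * deriv ψ s = 0) :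
    ∃ c : ℝ, g =ᵐ[volume.restrict (Ioo 0 L)] fun _ => c := by
  obtain ⟨ρ, hρ, hρ1⟩ := IsTestFunction.exists_integral_eq_one hL
  refine ⟨∫ s in Ioo 0 L, g s * ρ s, ?_⟩
  set c := ∫ s in Ioo 0 L, g s * ρ s with hc
  have hint : IntegrableOn (fun s => g s - c) (Ioo 0 L) := hg.sub (integrable_const c)
  have key := isOpen_Ioo.ae_eq_zero_of_integral_contDiff_smul_eq_zero
    hint.locallyIntegrableOn (fun η hη1 hη2 hη3 => ?_)
  · rw [EventuallyEq, ae_restrict_iff' measurableSet_Ioo]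
    filter_upwards [key] with s hs hs'
    exact sub_eq_zero.1 (hs hs')
  · have hη : IsTestFunction L η := ⟨hη1, hη2, hη3⟩
    set m := ∫ s in (0 : ℝ)..L, η s with hm
    obtain ⟨ψ, hψ, hψ'⟩ := hη.exists_primitive hρ hL (m := m) (by
      rw [intervalIntegral.integral_sub (hη.continuous.intervalIntegrable _ _)
        ((hρ.continuous.intervalIntegrable _ _).const_mul m),
        intervalIntegral.integral_const_mul, hρ1]
      simp [hm])
    have h1 := h ψ hψ
    rw [hψ'] at h1
    have h2 : ∫ s in Ioo 0 L, g s * (η s - m * ρ s) = (∫ s in Ioo 0 L, g s * η s) - m * c := by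
      rw [hc, ← integral_const_mul, ← integral_sub (hgc η hη.continuous)
        ((hgc ρ hρ.continuous).const_mul m)]
      refine integral_congr_ae (ae_of_all _ fun s => ?_)
      simp only
      ring
    have h3 : ∫ s, η s • (g s - c) = ∫ s in Ioo 0 L, η s • (g s - c) := by
      rw [setIntegral_eq_integral_of_forall_compl_eq_zero]
      intro s hs
      rw [hη.eq_zero_of_notMem hs, zero_smul]
    have h4 : ∫ s in Ioo 0 L, η s • (g s - c)
        = (∫ s in Ioo 0 L, g s * η s) - c * ∫ s in Ioo 0 L, η s := by
      rw [← integral_const_mul, ← integral_sub (hgc η hη.continuous)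
        (((memLp_of_continuousOn hη.continuous.continuousOn).integrable (by norm_num)).const_mul c)]
      refine integral_congr_ae (ae_of_all _ fun s => ?_)
      simp only [smul_eq_mul]
      ring
    rw [h3, h4, ← intervalIntegral_eq_setIntegral_Ioo hL η, ← hm]
    have h5 : ∫ s in Ioo 0 L, g s * (η s - m * ρ s) = 0 := h1
    linarith

/-! ### Primitives of `L²` functions and the space `H¹₀(0, L)` -/

/-- The primitive `s ↦ ∫₀ˢ h` of `h ∈ L²(0, L)`, as a continuous function on `ℝ`. The function `h`
is cut off outside `(0, L)`, where its representative carries no information. -/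
def primitive {L : ℝ} (h : L2 L) (s : ℝ) : ℝ :=
  ∫ x in (0 : ℝ)..s, (Ioo 0 L).indicator h x

section primitive

variable {L : ℝ}

lemma integrable_indicator_L2 (h : L2 L) : Integrable ((Ioo 0 L).indicator h) :=
  (integrable_indicator_iff measurableSet_Ioo).2 (integrableOn_L2 h)

lemma continuous_primitive (h : L2 L) : Continuous (primitive h) :=
  intervalIntegral.continuous_primitive
    (fun _ _ => (integrable_indicator_L2 h).intervalIntegrable) 0

lemma primitive_right (hL : 0 < L) (h : L2 L) : primitive h L = ∫ s in Ioo 0 L, h s := by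
  unfold primitive
  rw [intervalIntegral_eq_setIntegral_Ioo hL]
  exact setIntegral_congr_fun measurableSet_Ioo fun s hs => indicator_of_mem hs _

lemma primitive_eq_integral {h : L2 L} {F : ℝ → ℝ}
    (hF : (h : ℝ → ℝ) =ᵐ[volume.restrict (Ioo 0 L)] F) {s : ℝ} (hs : s ∈ Icc 0 L) :
    primitive h s = ∫ x in (0 : ℝ)..s, F x := by
  unfold primitive
  rw [intervalIntegral.integral_of_le hs.1, intervalIntegral.integral_of_le hs.1,
    integral_Ioc_eq_integral_Ioo, integral_Ioc_eq_integral_Ioo]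
  rw [EventuallyEq, ae_restrict_iff' measurableSet_Ioo] at hF
  refine setIntegral_congr_ae measurableSet_Ioo ?_
  filter_upwards [hF] with x hx hxs
  have hx' : x ∈ Ioo 0 L := ⟨hxs.1, hxs.2.trans_le hs.2⟩
  rw [indicator_of_mem hx', hx hx']

lemma ae_indicator_eq {h k : ℝ → ℝ} (hk : h =ᵐ[volume.restrict (Ioo 0 L)] k) :
    ∀ᵐ x, (Ioo 0 L).indicator h x = (Ioo 0 L).indicator k x := by
  rw [EventuallyEq, ae_restrict_iff' measurableSet_Ioo] at hk
  filter_upwards [hk] with x hx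
  by_cases hx' : x ∈ Ioo 0 L
  · rw [indicator_of_mem hx', indicator_of_mem hx', hx hx']
  · rw [indicator_of_notMem hx', indicator_of_notMem hx']

lemma primitive_add (h k : L2 L) (s : ℝ) :
    primitive (h + k) s = primitive h s + primitive k s := by
  unfold primitive
  rw [← intervalIntegral.integral_add (integrable_indicator_L2 h).intervalIntegrable
    (integrable_indicator_L2 k).intervalIntegrable]
  refine intervalIntegral.integral_congr_ae ?_
  filter_upwards [ae_indicator_eq (Lp.coeFn_add h k)] with x hx _
  rw [hx, indicator_add']
  rfl

lemma primitive_smul (c : ℝ) (h : L2 L) (s : ℝ) :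
    primitive (c • h) s = c * primitive h s := by
  unfold primitive
  rw [← intervalIntegral.integral_const_mul]
  refine intervalIntegral.integral_congr_ae ?_
  filter_upwards [ae_indicator_eq (Lp.coeFn_smul c h)] with x hx _
  rw [hx]
  by_cases hx' : x ∈ Ioo 0 L <;> simp [hx']

lemma abs_primitive_le (h : L2 L) {s : ℝ} (hs : s ∈ Icc 0 L) :
    |primitive h s| ≤ (volume.restrict (Ioo 0 L)).real univ ^ ((1 : ℝ) / 2) * ‖h‖ := by
  have hfin : volume.restrict (Ioo 0 L) (Ioo 0 s) ≠ ⊤ := measure_ne_top _ _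
  have h1 := L2.inner_indicatorConstLp_one (𝕜 := ℝ) measurableSet_Ioo hfin h
  have h2 : primitive h s = ∫ x in Ioo 0 s, h x ∂(volume.restrict (Ioo 0 L)) := by
    rw [primitive_eq_integral (EventuallyEq.refl _ _) hs, intervalIntegral.integral_of_le hs.1,
      integral_Ioc_eq_integral_Ioo, Measure.restrict_restrict measurableSet_Ioo,
      inter_eq_left.2 (Ioo_subset_Ioo_right hs.2)]
  rw [h2, ← h1]
  refine (abs_real_inner_le_norm _ _).trans ?_
  gcongr
  refine norm_indicatorConstLp_le.trans ?_
  simp only [norm_one, one_mul, ENNReal.toReal_ofNat]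
  gcongr
  · exact measure_ne_top _ _
  · exact subset_univ _

/-- The Volterra operator `h ↦ ∫₀ˢ h` on `L²(0, L)`. -/
def volterra (L : ℝ) : L2 L →L[ℝ] L2 L :=
  LinearMap.mkContinuous
    { toFun := fun h => (memLp_of_continuousOn (continuous_primitive h).continuousOn).toLp _
      map_add' := fun h k => by
        rw [← MemLp.toLp_add, MemLp.toLp_eq_toLp_iff]
        exact ae_of_all _ fun s => primitive_add h k s
      map_smul' := fun c h => by
        rw [RingHom.id_apply, ← MemLp.toLp_const_smul, MemLp.toLp_eq_toLp_iff]
        exact ae_of_all _ fun s => primitive_smul c h s }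
    ((measureUnivNNReal (volume.restrict (Ioo 0 L)) : ℝ) ^ (2 : ENNReal).toReal⁻¹ *
      (volume.restrict (Ioo 0 L)).real univ ^ ((1 : ℝ) / 2)) (fun h => by
    rw [mul_assoc]
    refine Lp.norm_le_of_ae_bound (by positivity) ?_
    filter_upwards [MemLp.coeFn_toLp (memLp_of_continuousOn (continuous_primitive h).continuousOn),
      ae_restrict_mem measurableSet_Ioo] with s h1 h2
    simp only [LinearMap.coe_mk, AddHom.coe_mk]
    rw [h1]
    exact abs_primitive_le h (Ioo_subset_Icc_self h2))

lemma coeFn_volterra (h : L2 L) :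
    (volterra L h : ℝ → ℝ) =ᵐ[volume.restrict (Ioo 0 L)] primitive h :=
  MemLp.coeFn_toLp (memLp_of_continuousOn (continuous_primitive h).continuousOn)

end primitive

section H10

variable {L : ℝ}

lemma mem_testPairs {ψ : ℝ → ℝ} (hψ : IsTestFunction L ψ) {p : L2 L × L2 L}
    (h1 : (p.1 : ℝ → ℝ) =ᵐ[volume.restrict (Ioo 0 L)] ψ)
    (h2 : (p.2 : ℝ → ℝ) =ᵐ[volume.restrict (Ioo 0 L)] deriv ψ) : p ∈ testPairs L :=
  ⟨ψ, hψ.contDiff, hψ.hasCompactSupport, hψ.tsupport_subset, h1, h2⟩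

lemma mem_H10_of_mem_testPairs {p : L2 L × L2 L} (hp : p ∈ testPairs L) : p ∈ H10 L :=
  (Submodule.span ℝ (testPairs L)).le_topologicalClosure (Submodule.subset_span hp)

/-- A continuous linear condition holds on `H¹₀` as soon as it holds for test functions. -/
lemma eq_zero_of_mem_H10 {E : Type*} [NormedAddCommGroup E] [NormedSpace ℝ E]
    (T : L2 L × L2 L →L[ℝ] E)
    (h : ∀ ψ, IsTestFunction L ψ → ∀ p : L2 L × L2 L,
      (p.1 : ℝ → ℝ) =ᵐ[volume.restrict (Ioo 0 L)] ψ →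
      (p.2 : ℝ → ℝ) =ᵐ[volume.restrict (Ioo 0 L)] deriv ψ → T p = 0)
    {p : L2 L × L2 L} (hp : p ∈ H10 L) : T p = 0 := by
  have hle : H10 L ≤ LinearMap.ker (T : L2 L × L2 L →ₗ[ℝ] E) := by
    refine Submodule.topologicalClosure_minimal _ (Submodule.span_le.2 ?_) T.isClosed_ker
    rintro p ⟨ψ, h1, h2, h3, h4, h5⟩
    exact h ψ ⟨h1, h2, h3⟩ p h4 h5
  exact LinearMap.mem_ker.1 (hle hp)

lemma IsTestFunction.integral_deriv {ψ : ℝ → ℝ} (hψ : IsTestFunction L ψ) (s : ℝ) :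
    ∫ x in (0 : ℝ)..s, deriv ψ x = ψ s := by
  rw [intervalIntegral.integral_eq_sub_of_hasDerivAt (fun x _ => hψ.hasDerivAt x)
    (hψ.continuous_deriv.intervalIntegrable _ _), hψ.apply_zero, sub_zero]

/-- The function in a pair of `H¹₀` is the primitive of the derivative. -/
lemma fst_eq_volterra {p : L2 L × L2 L} (hp : p ∈ H10 L) : p.1 = volterra L p.2 := by
  refine sub_eq_zero.1 (eq_zero_of_mem_H10 (ContinuousLinearMap.fst ℝ (L2 L) (L2 L)
    - (volterra L).comp (ContinuousLinearMap.snd ℝ (L2 L) (L2 L))) (fun ψ hψ p h1 h2 => ?_) hp)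
  change p.1 - volterra L p.2 = 0
  rw [sub_eq_zero]
  refine Lp.ext ?_
  filter_upwards [h1, coeFn_volterra p.2, ae_restrict_mem measurableSet_Ioo] with s hs1 hs2 hs3
  rw [hs1, hs2, primitive_eq_integral h2 (Ioo_subset_Icc_self hs3), hψ.integral_deriv]

/-- The boundary condition at `L`, as a linear condition on the derivative. -/
lemma integral_snd_eq_zero (hL : 0 < L) {p : L2 L × L2 L} (hp : p ∈ H10 L) :
    ∫ s in Ioo 0 L, p.2 s = 0 := by
  obtain ⟨e, he⟩ := exists_ae_eq_of_continuousOn (L := L) (F := fun _ => (1 : ℝ)) (by fun_prop)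
  have h := eq_zero_of_mem_H10 ((innerSL ℝ e).comp (ContinuousLinearMap.snd ℝ (L2 L) (L2 L)))
    (fun ψ hψ p h1 h2 => by
      change inner ℝ e p.2 = 0
      rw [inner_eq_setIntegral he h2, ← intervalIntegral_eq_setIntegral_Ioo hL]
      simp only [one_mul]
      rw [hψ.integral_deriv, hψ.apply_right]) hp
  change inner ℝ e p.2 = 0 at h
  rw [inner_eq_setIntegral he (EventuallyEq.refl _ _)] at h
  simpa using! h

/-- Every `h ∈ L²` of mean zero is the derivative of an element of `H¹₀`: by the lemma of
du Bois-Reymond, the derivatives of test functions are dense in the orthogonal complement of the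
constants. -/
lemma volterra_mem_H10 (hL : 0 < L) {h : L2 L} (h0 : ∫ s in Ioo 0 L, h s = 0) :
    (volterra L h, h) ∈ H10 L := by
  let D : Submodule ℝ (L2 L) := Submodule.span ℝ {g | ∃ ψ, IsTestFunction L ψ ∧
    (g : ℝ → ℝ) =ᵐ[volume.restrict (Ioo 0 L)] deriv ψ}
  let T : L2 L →L[ℝ] L2 L × L2 L := (volterra L).prod (ContinuousLinearMap.id ℝ (L2 L))
  have hDT : D.topologicalClosure ≤ (H10 L).comap (T : L2 L →ₗ[ℝ] L2 L × L2 L) := by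
    refine Submodule.topologicalClosure_minimal _ (Submodule.span_le.2 ?_) ?_
    · rintro g ⟨ψ, hψ, hg⟩
      refine mem_H10_of_mem_testPairs (mem_testPairs hψ ?_ hg)
      change (volterra L g : ℝ → ℝ) =ᵐ[volume.restrict (Ioo 0 L)] ψ
      filter_upwards [coeFn_volterra g, ae_restrict_mem measurableSet_Ioo] with s hs1 hs2
      rw [hs1, primitive_eq_integral hg (Ioo_subset_Icc_self hs2), hψ.integral_deriv]
    · exact (Submodule.isClosed_topologicalClosure _).preimage T.continuous
  refine hDT (x := h) ?_
  rw [← Submodule.orthogonal_orthogonal_eq_closure, Submodule.mem_orthogonal]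
  intro g hg
  rw [Submodule.mem_orthogonal] at hg
  obtain ⟨c, hc⟩ := exists_ae_eq_const hL (integrableOn_L2 g)
    (fun F hF => integrableOn_L2_mul g hF.continuousOn) fun ψ hψ => by
      obtain ⟨k, hk⟩ := exists_ae_eq_of_continuousOn (L := L) hψ.continuous_deriv.continuousOn
      rw [← inner_eq_setIntegral (EventuallyEq.refl _ _) hk, real_inner_comm]
      exact hg k (Submodule.subset_span ⟨ψ, hψ, hk⟩)
  rw [inner_eq_setIntegral hc (EventuallyEq.refl _ _), integral_const_mul, h0, mul_zero]

end H10

/-! ### Eigenfunctions are the classical Dirichlet solutions -/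

section eigenspace

variable {L t : ℝ} {v q : ℝ → ℝ}

/-- Regularity: every element of the eigenspace is a classical solution of the Dirichlet problem.
The weak equation says that `f'` plus the primitive of `q f` is orthogonal to the derivatives of
test functions, hence constant. -/
theorem exists_isSolution_of_mem_eigenspace (hL : 0 < L) (hq : Continuous q)
    (hqv : ∀ s ∈ Icc 0 L, q s = t - v s) {f : L2 L} (hf : f ∈ eigenspace L v t) :
    ∃ w w' : ℝ → ℝ, IsSolution q L w w' ∧ w 0 = 0 ∧ w L = 0 ∧
      (f : ℝ → ℝ) =ᵐ[volume.restrict (Ioo 0 L)] w := by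
  obtain ⟨k, ⟨g, hg, hgk⟩, hk⟩ := hf
  change (f, g) ∈ H10 L at hg
  change ∀ q ∈ H10 L, inner ℝ g q.2 = inner ℝ k q.1 at hgk
  change ((t • f : L2 L) : ℝ → ℝ) =ᵐ[volume.restrict (Ioo 0 L)] fun s => k s + v s * f s at hk
  have hfg : f = volterra L g := fst_eq_volterra hg
  have hφ := continuous_primitive g
  have hfφ : (f : ℝ → ℝ) =ᵐ[volume.restrict (Ioo 0 L)] primitive g := by
    rw [hfg]
    exact coeFn_volterra g
  have hkφ : (k : ℝ → ℝ) =ᵐ[volume.restrict (Ioo 0 L)] fun s => q s * primitive g s := by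
    filter_upwards [hk, hfφ, Lp.coeFn_smul t f, ae_restrict_mem measurableSet_Ioo]
      with s h1 h2 h3 h4
    rw [h3, Pi.smul_apply, smul_eq_mul, h2] at h1
    rw [hqv s (Ioo_subset_Icc_self h4)]
    linarith
  have hqφ : Continuous fun s => q s * primitive g s := hq.mul hφ
  let P : ℝ → ℝ := fun s => ∫ x in (0 : ℝ)..s, q x * primitive g x
  have hP : ∀ s, HasDerivAt P (q s * primitive g s) s := fun s =>
    (hqφ.integral_hasStrictDerivAt 0 s).hasDerivAt
  have hPc : Continuous P := continuous_iff_continuousAt.2 fun s => (hP s).continuousAt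
  obtain ⟨c, hc⟩ := exists_ae_eq_const hL (g := fun s => g s + P s)
    ((integrableOn_L2 g).add
      ((memLp_of_continuousOn hPc.continuousOn).integrable (by norm_num)))
    (fun F hF => by
      simp only [add_mul]
      exact (integrableOn_L2_mul g hF.continuousOn).add
        ((memLp_of_continuousOn (hPc.mul hF).continuousOn).integrable (by norm_num)))
    (fun ψ hψ => by
      obtain ⟨a, ha⟩ := exists_ae_eq_of_continuousOn (L := L) hψ.continuous.continuousOn
      obtain ⟨b, hb⟩ := exists_ae_eq_of_continuousOn (L := L) hψ.continuous_deriv.continuousOn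
      have h1 := hgk (a, b) (mem_H10_of_mem_testPairs (mem_testPairs hψ ha hb))
      simp only at h1
      rw [inner_eq_setIntegral (EventuallyEq.refl _ _) hb, inner_eq_setIntegral hkφ ha,
        ← intervalIntegral_eq_setIntegral_Ioo hL (fun s => q s * primitive g s * ψ s)] at h1
      have h2 := intervalIntegral.integral_mul_deriv_eq_deriv_mul (a := 0) (b := L)
        (fun s _ => hP s) (fun s _ => hψ.hasDerivAt s) (hqφ.intervalIntegrable _ _)
        (hψ.continuous_deriv.intervalIntegrable _ _)
      rw [hψ.apply_zero, hψ.apply_right, mul_zero, mul_zero, sub_zero, zero_sub,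
        intervalIntegral_eq_setIntegral_Ioo hL (fun s => P s * deriv ψ s)] at h2
      simp only [add_mul]
      have h3 : IntegrableOn (fun s => P s * deriv ψ s) (Ioo 0 L) :=
        (memLp_of_continuousOn (hPc.mul hψ.continuous_deriv).continuousOn).integrable
          (by norm_num)
      rw [integral_add (integrableOn_L2_mul g hψ.continuous_deriv.continuousOn) h3, h1, h2]
      ring)
  have hgc : (g : ℝ → ℝ) =ᵐ[volume.restrict (Ioo 0 L)] fun s => c - P s := by
    filter_upwards [hc] with s hs
    linarith
  have hcP : Continuous fun s => c - P s := by fun_prop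
  let w : ℝ → ℝ := fun s => ∫ x in (0 : ℝ)..s, (c - P x)
  have hw : ∀ s, HasDerivAt w (c - P s) s := fun s =>
    (hcP.integral_hasStrictDerivAt 0 s).hasDerivAt
  have hwφ : ∀ s ∈ Icc 0 L, primitive g s = w s := fun s hs => primitive_eq_integral hgc hs
  refine ⟨w, fun s => c - P s, ⟨fun s _ => hw s, fun s hs => ?_⟩,
    intervalIntegral.integral_same, ?_, ?_⟩
  · rw [← hwφ s hs]
    exact (hP s).const_sub c
  · rw [← hwφ L ⟨hL.le, le_rfl⟩, primitive_right hL]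
    exact integral_snd_eq_zero hL hg
  · filter_upwards [hfφ, ae_restrict_mem measurableSet_Ioo] with s h1 h2
    rw [h1, hwφ s (Ioo_subset_Icc_self h2)]

/-- Classical solutions of the Dirichlet problem belong to the eigenspace. -/
theorem mem_eigenspace_of_isSolution (hL : 0 < L) (hq : Continuous q)
    (hqv : ∀ s ∈ Icc 0 L, q s = t - v s) {w w' : ℝ → ℝ} (hw : IsSolution q L w w')
    (h0 : w 0 = 0) (hwL : w L = 0) {f : L2 L}
    (hf : (f : ℝ → ℝ) =ᵐ[volume.restrict (Ioo 0 L)] w) : f ∈ eigenspace L v t := by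
  have hqw : ContinuousOn (fun s => q s * w s) (Icc 0 L) := hq.continuousOn.mul hw.continuousOn
  obtain ⟨g, hg⟩ := exists_ae_eq_of_continuousOn hw.continuousOn_deriv
  obtain ⟨k, hk⟩ := exists_ae_eq_of_continuousOn hqw
  have hint : ∀ s ∈ Icc 0 L, ∫ x in (0 : ℝ)..s, w' x = w s := by
    intro s hs
    have hsub : uIcc 0 s ⊆ Icc 0 L := by
      rw [uIcc_of_le hs.1]
      exact Icc_subset_Icc_right hs.2
    rw [intervalIntegral.integral_eq_sub_of_hasDerivAt (fun x hx => hw.hasDerivAt x (hsub hx))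
      (hw.continuousOn_deriv.mono hsub).intervalIntegrable, h0, sub_zero]
  have hfg : f = volterra L g := by
    refine Lp.ext ?_
    filter_upwards [hf, coeFn_volterra g, ae_restrict_mem measurableSet_Ioo] with s h1 h2 h3
    rw [h1, h2, primitive_eq_integral hg (Ioo_subset_Icc_self h3),
      hint s (Ioo_subset_Icc_self h3)]
  refine ⟨k, ⟨g, ?_, fun p hp => ?_⟩, ?_⟩
  · change (f, g) ∈ H10 L
    rw [hfg]
    refine volterra_mem_H10 hL ?_
    rw [← primitive_right hL, primitive_eq_integral hg ⟨hL.le, le_rfl⟩,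
      hint L ⟨hL.le, le_rfl⟩, hwL]
  · change inner ℝ g p.2 = inner ℝ k p.1
    refine sub_eq_zero.1 (eq_zero_of_mem_H10
      ((innerSL ℝ g).comp (ContinuousLinearMap.snd ℝ (L2 L) (L2 L))
        - (innerSL ℝ k).comp (ContinuousLinearMap.fst ℝ (L2 L) (L2 L)))
      (fun ψ hψ p h1 h2 => ?_) hp)
    change inner ℝ g p.2 - inner ℝ k p.1 = 0
    rw [inner_eq_setIntegral hg h2, inner_eq_setIntegral hk h1,
      ← intervalIntegral_eq_setIntegral_Ioo hL, ← intervalIntegral_eq_setIntegral_Ioo hL]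
    have h3 := intervalIntegral.integral_mul_deriv_eq_deriv_mul (a := 0) (b := L)
      (u := w') (u' := fun s => -(q s * w s)) (v := ψ) (v' := deriv ψ)
      (fun s hs => hw.hasDerivAt_deriv s (by rwa [uIcc_of_le hL.le] at hs))
      (fun s _ => hψ.hasDerivAt s) (intervalIntegrable_of_continuousOn hL hqw.neg)
      (hψ.continuous_deriv.intervalIntegrable _ _)
    rw [h3, hψ.apply_zero, hψ.apply_right]
    simp
  · change ((t • f : L2 L) : ℝ → ℝ) =ᵐ[volume.restrict (Ioo 0 L)] fun s => k s + v s * f s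
    filter_upwards [hf, hk, Lp.coeFn_smul t f, ae_restrict_mem measurableSet_Ioo]
      with s h1 h2 h3 h4
    rw [h3, Pi.smul_apply, smul_eq_mul, h2, h1, hqv s (Ioo_subset_Icc_self h4)]
    ring

/-- The dimension of an eigenspace is decided by the Prüfer angle at the right end point. -/
theorem eigenspace_of_isPruferAngle (hL : 0 < L) (hq : Continuous q)
    (hqv : ∀ s ∈ Icc 0 L, q s = t - v s) {θ : ℝ → ℝ} (hθ : IsPruferAngle q L θ) :
    (Real.sin (θ L) = 0 → Module.rank ℝ (eigenspace L v t) = 1) ∧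
      (Real.sin (θ L) ≠ 0 → Module.rank ℝ (eigenspace L v t) = 0) := by
  obtain ⟨M, hM⟩ := (isCompact_Icc (a := (0 : ℝ)) (b := L)).exists_bound_of_continuousOn
    hq.continuousOn
  obtain ⟨r, hr0, hr, hu⟩ := hθ.exists_isSolution hq hL
  -- Every eigenfunction is a multiple of the solution `r sin θ`.
  have key : ∀ f ∈ eigenspace L v t, ∃ A : ℝ, A * (r L * Real.sin (θ L)) = 0 ∧
      (f : ℝ → ℝ) =ᵐ[volume.restrict (Ioo 0 L)] fun s => A * (r s * Real.sin (θ s)) := by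
    intro f hf
    obtain ⟨w, w', hw, hw0, hwL, hfw⟩ := exists_isSolution_of_mem_eigenspace hL hq hqv hf
    have h := hw.eq_mul hu hM hL hw0 (by simp [hθ.zero]) (by simp [hθ.zero, hr0])
    refine ⟨w' 0, by rw [← h L ⟨hL.le, le_rfl⟩, hwL], ?_⟩
    filter_upwards [hfw, ae_restrict_mem measurableSet_Ioo] with s h1 h2
    rw [h1, h s (Ioo_subset_Icc_self h2)]
  constructor
  · intro hsin
    obtain ⟨e, he⟩ := exists_ae_eq_of_continuousOn hu.continuousOn
    rw [rank_submodule_eq_one_iff]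
    refine ⟨e, mem_eigenspace_of_isSolution hL hq hqv hu (by simp [hθ.zero]) (by simp [hsin]) he,
      fun he0 => ?_, fun f hf => ?_⟩
    · have h0 : (fun s => r s * Real.sin (θ s)) =ᵐ[volume.restrict (Ioo 0 L)] fun _ => 0 := by
        rw [he0] at he
        exact he.symm.trans (Lp.coeFn_zero _ _ _)
      have h1 := Measure.eqOn_open_of_ae_eq h0 isOpen_Ioo
        (hu.continuousOn.mono Ioo_subset_Icc_self) continuousOn_const
      have hmid : L / 2 ∈ Ioo 0 L := ⟨by linarith, by linarith⟩
      have h2 : HasDerivAt (fun s => r s * Real.sin (θ s)) 0 (L / 2) := by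
        refine (hasDerivAt_const (L / 2) (0 : ℝ)).congr_of_eventuallyEq ?_
        filter_upwards [isOpen_Ioo.mem_nhds hmid] with s hs using h1 hs
      have h3 := h2.unique (hu.hasDerivAt _ (Ioo_subset_Icc_self hmid))
      have h4 : Real.cos (θ (L / 2)) = 0 := by simpa [(hr _).ne'] using h3.symm
      have h5 : Real.sin (θ (L / 2)) = 0 := by simpa [(hr _).ne'] using h1 hmid
      have h6 := Real.sin_sq_add_cos_sq (θ (L / 2))
      rw [h4, h5] at h6
      norm_num at h6
    · obtain ⟨A, -, hA⟩ := key f hf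
      refine Submodule.mem_span_singleton.2 ⟨A, Lp.ext ?_⟩
      filter_upwards [hA, he, Lp.coeFn_smul A e] with s h1 h2 h3
      rw [h1, h3, Pi.smul_apply, h2, smul_eq_mul]
  · intro hsin
    have hbot : eigenspace L v t = ⊥ := by
      rw [eq_bot_iff]
      intro f hf
      obtain ⟨A, hA0, hA⟩ := key f hf
      have hA' : A = 0 := by simpa [(hr L).ne', hsin] using hA0
      rw [Submodule.mem_bot]
      refine Lp.ext ?_
      filter_upwards [hA, Lp.coeFn_zero ℝ 2 ((volume : Measure ℝ).restrict (Ioo 0 L))]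
        with s h1 h2
      rw [h1, h2, hA']
      simp
    rw [hbot, rank_bot]

end eigenspace

/-! ### The spectrum -/

/-- The Prüfer angles of all the equations `u'' + (t - w) u = 0`: at the right end point they
increase strictly and continuously with `t`. -/
theorem exists_pruferAngle_family {L C : ℝ} (hL : 0 < L) {w : ℝ → ℝ} (hw : Continuous w)
    (hC : ∀ s, |w s| ≤ C) :
    ∃ θ : ℝ → ℝ → ℝ, (∀ t, IsPruferAngle (fun s => t - w s) L (θ t)) ∧
      StrictMono (fun t => θ t L) ∧ Continuous fun t => θ t L := by
  have hbd : ∀ t s, |t - w s| ≤ |t| + C := fun t s =>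
    (abs_sub _ _).trans (by linarith [hC s])
  choose θ hθ using fun t => exists_isPruferAngle (q := fun s => t - w s) (by fun_prop) (hbd t) hL
  refine ⟨θ, hθ, fun t₁ t₂ ht => ?_, continuous_iff_continuousAt.2 fun t => ?_⟩
  · refine (hθ t₁).strictMono (M := |t₁| + |t₂| + C) (hθ t₂) hL (fun s _ => ?_) (fun s _ => ?_)
      fun s _ => by simpa using ht
    · linarith [hbd t₁ s, abs_nonneg t₂]
    · linarith [hbd t₂ s, abs_nonneg t₁]
  · have hlim : Tendsto (fun t' => |t' - t| * Real.exp ((1 + (|t| + C)) * L)) (𝓝 t) (𝓝 0) := by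
      have h : Continuous fun t' => |t' - t| * Real.exp ((1 + (|t| + C)) * L) := by fun_prop
      simpa using h.tendsto t
    refine tendsto_iff_dist_tendsto_zero.2 (squeeze_zero (fun _ => dist_nonneg) (fun t' => ?_) hlim)
    rw [Real.dist_eq]
    refine (hθ t).abs_sub_le_of_abs_sub_le (hθ t') hL (fun s _ => hbd t s) fun s _ => ?_
    have h : t' - w s - (t - w s) = t' - t := by ring
    rw [h]

/-- A monotone sequence with the same multiplicities as a strictly monotone one equals it. -/
lemma eq_of_mk_fiber_eq {μ lam : ℕ+ → ℝ} (hμ : Monotone μ) (hlam : StrictMono lam)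
    (h : ∀ t, Cardinal.mk {n : ℕ+ // μ n = t} = Cardinal.mk {n : ℕ+ // lam n = t}) : μ = lam := by
  have hsub : ∀ t, Subsingleton {n : ℕ+ // lam n = t} := fun t =>
    ⟨fun a b => Subtype.ext (hlam.injective (a.2.trans b.2.symm))⟩
  have hinj : Function.Injective μ := by
    intro a b hab
    have h1 : Cardinal.mk {n : ℕ+ // μ n = μ b} ≤ 1 := by
      rw [h]
      exact Cardinal.le_one_iff_subsingleton.2 (hsub _)
    have h2 := Cardinal.le_one_iff_subsingleton.1 h1
    exact congrArg Subtype.val (h2.elim ⟨a, hab⟩ ⟨b, rfl⟩)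
  refine ((hμ.strictMono_of_injective hinj).range_inj hlam).1 (Set.ext fun t => ?_)
  have h1 : Nonempty {n : ℕ+ // μ n = t} ↔ Nonempty {n : ℕ+ // lam n = t} := by
    rw [← Cardinal.mk_ne_zero_iff, ← Cardinal.mk_ne_zero_iff, h]
  simpa [nonempty_subtype] using h1

/-- The `n`-th eigenvalue is the parameter at which the Prüfer angle ends at `n π`. -/
theorem exists_eigenvalueSeq {L C : ℝ} (hL : 0 < L) {v w : ℝ → ℝ} (hw : Continuous w)
    (hC : ∀ s, |w s| ≤ C) (hvw : ∀ s ∈ Icc 0 L, w s = v s) {θ : ℝ → ℝ → ℝ}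
    (hθ : ∀ t, IsPruferAngle (fun s => t - w s) L (θ t)) (hmono : StrictMono fun t => θ t L)
    (hcont : Continuous fun t => θ t L) :
    ∃ lam : ℕ+ → ℝ, IsEigenvalueSeq L v lam ∧ StrictMono lam ∧ (∀ n, θ (lam n) L = n * Real.pi) ∧
      ∀ n : ℕ+, ((n : ℝ) * Real.pi / L) ^ 2 - C ≤ lam n ∧ lam n ≤ ((n : ℝ) * Real.pi / L) ^ 2 + C := by
  have hC' := fun s => abs_le.1 (hC s)
  have hex : ∀ n : ℕ+, ∃ t ∈ Icc (((n : ℝ) * Real.pi / L) ^ 2 - C)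
      (((n : ℝ) * Real.pi / L) ^ 2 + C), θ t L = n * Real.pi := by
    intro n
    have hC0 : 0 ≤ C := (abs_nonneg _).trans (hC 0)
    refine intermediate_value_Icc (by linarith) hcont.continuousOn ⟨?_, ?_⟩
    · exact (hθ _).le_nat_mul_pi hL n.pos fun s _ => by linarith [(hC' s).1]
    · exact (hθ _).nat_mul_pi_le hL n.pos fun s _ => by linarith [(hC' s).2]
  choose lam hlam hlamθ using hex
  have hlamMono : StrictMono lam := fun a b hab => by
    refine hmono.lt_iff_lt.1 ?_
    have h1 : (a : ℝ) < b := by exact_mod_cast hab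
    simp only [hlamθ]
    exact mul_lt_mul_of_pos_right h1 Real.pi_pos
  refine ⟨lam, ⟨hlamMono.monotone, fun t => ?_⟩, hlamMono, hlamθ, fun n => hlam n⟩
  have hrank := eigenspace_of_isPruferAngle (t := t) (v := v) (q := fun s => t - w s) hL
    (by fun_prop) (fun s hs => by rw [hvw s hs]) (hθ t)
  by_cases hsin : Real.sin (θ t L) = 0
  · rw [hrank.1 hsin]
    obtain ⟨m, hm⟩ := Real.sin_eq_zero_iff.1 hsin
    -- The angle is positive at `L`, so the multiple of `π` is one with index at least `1`.
    have hpos : 0 < θ t L := (hθ t).pos (M := |t| + C)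
      (fun s _ => (abs_sub _ _).trans (by linarith [hC s])) ⟨hL, le_rfl⟩
    rw [← hm] at hpos
    have hm0 : 0 < m := by exact_mod_cast pos_of_mul_pos_left hpos Real.pi_pos.le
    lift m to ℕ using hm0.le
    have hm1 : 0 < m := by exact_mod_cast hm0
    obtain ⟨k, rfl⟩ : ∃ k : ℕ+, (k : ℕ) = m := ⟨⟨m, hm1⟩, rfl⟩
    have hlt : lam k = t := by
      refine hmono.injective ?_
      rw [hlamθ, ← hm]
      simp
    have huniq : Unique {n : ℕ+ // lam n = t} :=
      ⟨⟨⟨k, hlt⟩⟩, fun a => Subtype.ext (hlamMono.injective (a.2.trans hlt.symm))⟩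
    exact Cardinal.mk_eq_one _
  · rw [hrank.2 hsin]
    have hemp : IsEmpty {n : ℕ+ // lam n = t} := by
      refine ⟨fun a => hsin ?_⟩
      rw [← a.2, hlamθ]
      exact Real.sin_nat_mul_pi _
    exact Cardinal.mk_eq_zero _

/-! ### Nodal domains -/

lemma exists_mem_Icc_succ {n : ℕ} (z : Fin (n + 1) → ℝ) {s : ℝ} (h0 : z 0 ≤ s)
    (hn : s < z (Fin.last n)) : ∃ k : Fin n, s ∈ Icc (z k.castSucc) (z k.succ) := by
  by_contra! h
  have key : ∀ j : Fin (n + 1), z j ≤ s := by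
    intro j
    induction j using Fin.induction with
    | zero => exact h0
    | succ k ih =>
      by_contra! hk
      exact h k ⟨ih, hk.le⟩
  exact absurd (key (Fin.last n)) (not_le.2 hn)

/-- Zeros are boundary points of the nodal domains, provided that there are finitely many. -/
lemma mem_frontier_nonNodalSet {L : ℝ} (hL : 0 < L) {u : ℝ → ℝ} {Z : Set ℝ} (hZ : Z.Finite)
    (hu : ∀ s ∈ Ioo 0 L, u s = 0 → s ∈ Z) {s : ℝ} (hs : s ∈ Icc 0 L) (h0 : u s = 0) :
    s ∈ frontier (nonNodalSet L u) := by
  rw [frontier_eq_closure_inter_closure]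
  refine ⟨?_, subset_closure fun h => h.2 h0⟩
  have hsub : Ioo 0 L ∩ Zᶜ ⊆ nonNodalSet L u := fun x hx => ⟨hx.1, fun h => hx.2 (hu x hx.1 h)⟩
  have h1 : Ioo 0 L ⊆ closure (nonNodalSet L u) :=
    (hZ.countable.dense_compl ℝ).open_subset_closure_inter isOpen_Ioo |>.trans (closure_mono hsub)
  have h2 := closure_minimal h1 isClosed_closure
  rw [closure_Ioo hL.ne] at h2
  exact h2 hs

/-! ### Uniform bounds -/

/-- An `L²`-normalized eigenfunction is the solution `r sin θ` given by the Prüfer angle up to a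
non-zero factor, here absorbed into `r`. -/
lemma exists_normalized_solution {L t : ℝ} (hL : 0 < L) {v q θ : ℝ → ℝ} (hq : Continuous q)
    (hqv : ∀ s ∈ Icc 0 L, q s = t - v s) (hθ : IsPruferAngle q L θ) {f : L2 L}
    (hf : f ∈ eigenspace L v t) (hnorm : ‖f‖ = 1) :
    ∃ r : ℝ → ℝ, (∀ s, r s ≠ 0) ∧
      IsSolution q L (fun s => r s * Real.sin (θ s)) (fun s => r s * Real.cos (θ s)) ∧
      (f : ℝ → ℝ) =ᵐ[volume.restrict (Ioo 0 L)] (fun s => r s * Real.sin (θ s)) ∧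
      r L * Real.sin (θ L) = 0 ∧ ∫ s in (0 : ℝ)..L, (r s * Real.sin (θ s)) ^ 2 = 1 := by
  obtain ⟨M, hM⟩ := (isCompact_Icc (a := (0 : ℝ)) (b := L)).exists_bound_of_continuousOn
    hq.continuousOn
  obtain ⟨r, hr0, hr, hu⟩ := hθ.exists_isSolution hq hL
  obtain ⟨w, w', hw, hw0, hwL, hfw⟩ := exists_isSolution_of_mem_eigenspace hL hq hqv hf
  have h := hw.eq_mul hu hM hL hw0 (by simp [hθ.zero]) (by simp [hθ.zero, hr0])
  have hfu : (f : ℝ → ℝ) =ᵐ[volume.restrict (Ioo 0 L)]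
      fun s => w' 0 * r s * Real.sin (θ s) := by
    filter_upwards [hfw, ae_restrict_mem measurableSet_Ioo] with s h1 h2
    rw [h1, h s (Ioo_subset_Icc_self h2), mul_assoc]
  have hint : ∫ s in (0 : ℝ)..L, (w' 0 * r s * Real.sin (θ s)) ^ 2 = 1 := by
    rw [intervalIntegral_eq_setIntegral_Ioo hL]
    have h1 := real_inner_self_eq_norm_sq f
    rw [inner_eq_setIntegral hfu hfu, hnorm, one_pow] at h1
    simpa only [sq] using h1
  have hA : w' 0 ≠ 0 := by
    intro h0
    rw [h0] at hint
    simp at hint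
  refine ⟨fun s => w' 0 * r s, fun s => mul_ne_zero hA (hr s).ne', ?_, hfu, ?_, hint⟩
  · have h2 := hu.const_mul (w' 0)
    simpa only [mul_assoc] using h2
  · rw [mul_assoc, ← h L ⟨hL.le, le_rfl⟩, hwL]

end SturmDirichlet

end

open SturmDirichlet Set in
theorem mainTheorem12 (n : ℕ+) (L C : ℝ) (hL : 0 < L) (hC : 0 < C) :
    ∃ c : ℝ, 0 < c ∧
      ∀ v : ℝ → ℝ, ContDiffOn ℝ ∞ v (Set.Icc 0 L) → (∀ s ∈ Set.Icc 0 L, |v s| ≤ C) →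
        (∃ μ : ℕ+ → ℝ, SturmDirichlet.IsEigenvalueSeq L v μ) ∧
        ∀ μ : ℕ+ → ℝ, SturmDirichlet.IsEigenvalueSeq L v μ →
          ((n : ℝ) * Real.pi / L) ^ 2 - C ≤ μ n ∧
          μ n ≤ ((n : ℝ) * Real.pi / L) ^ 2 + C ∧
          c ≤ μ (n + 1) - μ n ∧
          ∀ f : SturmDirichlet.L2 L, f ∈ SturmDirichlet.eigenspace L v (μ n) → ‖f‖ = 1 →
            ∃ φ : ℝ → ℝ,
              (f : ℝ → ℝ) =ᵐ[MeasureTheory.volume.restrict (Set.Ioo 0 L)] φ ∧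
              ContDiffOn ℝ ∞ φ (Set.Icc 0 L) ∧
              SturmDirichlet.C2Norm L φ ≤ c⁻¹ ∧
              (∃ z : Fin ((n : ℕ) + 1) → ℝ, StrictMono z ∧ z 0 = 0 ∧ z (Fin.last (n : ℕ)) = L ∧
                Set.range z = {s | s ∈ Set.Icc 0 L ∧ φ s = 0} ∧
                ∀ k : Fin (n : ℕ), c ≤ z k.succ - z k.castSucc) ∧
              ∀ s ∈ Set.Ioo 0 L,
                c * Metric.infDist s (frontier (SturmDirichlet.nonNodalSet L φ)) ≤ |φ s| := by
  -- `M` bounds the potential `μₙ - v`, and `E₀`, `E₁` bound the energy `φ² + φ'²`. The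
  -- constants `c₂, …, c₅` serve the `C²` norm, the spectral gap, the spacing of the zeros and the
  -- lower bound on `|φ|`.
  set M : ℝ := ((n : ℝ) * Real.pi / L) ^ 2 + 2 * C with hMdef
  have hM0 : 0 < M := by positivity
  set X : ℝ := Real.exp ((1 + M) * L) with hX
  have hX0 : 0 < X := Real.exp_pos _
  set E₀ : ℝ := (L * X)⁻¹ with hE₀
  have hE₀0 : 0 < E₀ := by positivity
  set E₁ : ℝ := X * (1 + M) / L with hE₁
  have hE₁0 : 0 < E₁ := by positivity
  set c₂ : ℝ := ((2 + M) * (1 + E₁))⁻¹ with hc₂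
  have hc₂0 : 0 < c₂ := by positivity
  set c₃ : ℝ := Real.pi / X with hc₃
  have hc₃0 : 0 < c₃ := by positivity
  set c₄ : ℝ := Real.pi / (1 + M) with hc₄
  have hc₄0 : 0 < c₄ := by positivity
  set c₅ : ℝ := Real.sqrt E₀ * (2 / Real.pi * (2 + (1 + M) * L ^ 2)⁻¹) with hc₅
  have hc₅0 : 0 < c₅ := by positivity
  set c : ℝ := min (min c₂ c₃) (min c₄ c₅) with hc
  have hcc₂ : c ≤ c₂ := (min_le_left _ _).trans (min_le_left _ _)
  have hcc₃ : c ≤ c₃ := (min_le_left _ _).trans (min_le_right _ _)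
  have hcc₄ : c ≤ c₄ := (min_le_right _ _).trans (min_le_left _ _)
  have hcc₅ : c ≤ c₅ := (min_le_right _ _).trans (min_le_right _ _)
  have hc0 : 0 < c := lt_min (lt_min hc₂0 hc₃0) (lt_min hc₄0 hc₅0)
  refine ⟨c, hc0, fun v hv hvC => ?_⟩
  -- Outside `[0, L]` the values of `v` are irrelevant; `w` extends `v` by constants.
  obtain ⟨w, hw, hwC, hwv⟩ : ∃ w : ℝ → ℝ, Continuous w ∧ (∀ s, |w s| ≤ C) ∧
      ∀ s ∈ Icc 0 L, w s = v s :=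
    ⟨IccExtend hL.le ((Icc 0 L).domRestrict v),
      (continuousOn_iff_continuous_domRestrict.1 hv.continuousOn).Icc_extend',
      fun s => hvC _ (projIcc 0 L hL.le s).2, fun s hs => IccExtend_of_mem hL.le _ hs⟩
  obtain ⟨θ, hθ, hmono, hcont⟩ := exists_pruferAngle_family hL hw hwC
  obtain ⟨lam, hlam, hlamMono, hlamθ, hlamC⟩ := exists_eigenvalueSeq hL hw hwC hwv hθ hmono hcont
  refine ⟨⟨lam, hlam⟩, fun μ hμ => ?_⟩
  obtain rfl : μ = lam := eq_of_mk_fiber_eq hμ.monotone hlamMono fun t => by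
    rw [hμ.multiplicity, hlam.multiplicity]
  have hqM : ∀ s, |μ n - w s| ≤ M := fun s => by
    have h1 := hlamC n
    have h2 := abs_le.1 (hwC s)
    rw [abs_le]
    constructor <;> nlinarith [sq_nonneg ((n : ℝ) * Real.pi / L)]
  have hqM' : ∀ s ∈ Icc 0 L, |μ n - w s| ≤ M := fun s _ => hqM s
  have hq : Continuous fun s => μ n - w s := by fun_prop
  refine ⟨(hlamC n).1, (hlamC n).2, ?_, fun f hf hnorm => ?_⟩
  · have h := (hθ (μ n)).abs_sub_le_of_abs_sub_le (hθ (μ (n + 1))) hL hqM'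
      (ε := μ (n + 1) - μ n) fun s _ => by
        have h1 : μ n ≤ μ (n + 1) := hμ.monotone (PNat.lt_add_right n 1).le
        rw [sub_sub_sub_cancel_right, abs_of_nonneg (sub_nonneg.2 h1)]
    rw [hlamθ, hlamθ] at h
    have h2 : ((n + 1 : ℕ+) : ℝ) * Real.pi - n * Real.pi = Real.pi := by
      push_cast
      ring
    rw [h2, abs_of_pos Real.pi_pos] at h
    exact hcc₃.trans ((div_le_iff₀ hX0).2 h)
  obtain ⟨r, hr, hu, hfu, huL, hint⟩ := exists_normalized_solution hL hq
    (fun s hs => by rw [hwv s hs]) (hθ (μ n)) hf hnorm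
  have hθn := hθ (μ n)
  set ϑ := θ (μ n) with hϑ
  have hE : ∀ s ∈ Icc 0 L, E₀ ≤ r s ^ 2 ∧ r s ^ 2 ≤ E₁ := by
    intro s hs
    have h := hu.energy_bounds hq hqM' hL (by simp [hθn.zero]) huL hint hs
    have h1 : (r s * Real.sin (ϑ s)) ^ 2 + (r s * Real.cos (ϑ s)) ^ 2 = r s ^ 2 := by
      linear_combination r s ^ 2 * Real.sin_sq_add_cos_sq (ϑ s)
    rwa [h1] at h
  have hrB : ∀ s ∈ Icc 0 L, |r s| ≤ 1 + E₁ := by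
    intro s hs
    have h := (hE s hs).2
    rw [← sq_abs] at h
    -- `2 |r| ≤ 1 + r²` avoids a square root of `E₁`.
    nlinarith [sq_nonneg (|r s| - 1)]
  obtain ⟨z, hz, hz0, hzL, hzθ, hzall⟩ := hθn.exists_nodes hL hqM' (hlamθ n)
  have hzeros : range z = {s | s ∈ Icc 0 L ∧ r s * Real.sin (ϑ s) = 0} := by
    ext s
    constructor
    · rintro ⟨k, rfl⟩
      refine ⟨(hzθ k).1, ?_⟩
      rw [(hzθ k).2, Real.sin_nat_mul_pi, mul_zero]
    · rintro ⟨hs, h0⟩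
      have h1 : Real.sin (ϑ s) = 0 := by simpa [hr s] using h0
      obtain ⟨m, hm⟩ := Real.sin_eq_zero_iff.1 h1
      exact hzall s hs m hm.symm
  refine ⟨fun s => r s * Real.sin (ϑ s), hfu, ?_, ?_, ⟨z, hz, hz0, hzL, hzeros, fun k => ?_⟩,
    fun s hs => ?_⟩
  · refine hu.contDiffOn hL ?_
    exact ((contDiffOn_const (c := μ n)).sub hv).congr fun s hs => by simp [hwv s hs]
  · refine (hu.C2Norm_le hqM' hL (B := 1 + E₁) fun s hs => ?_).trans ?_
    · have h1 := hrB s hs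
      rw [abs_mul, abs_mul]
      exact ⟨(mul_le_of_le_one_right (abs_nonneg _) (Real.abs_sin_le_one _)).trans h1,
        (mul_le_of_le_one_right (abs_nonneg _) (Real.abs_cos_le_one _)).trans h1⟩
    · rw [← inv_inv ((2 + M) * (1 + E₁))]
      exact inv_anti₀ hc0 hcc₂
  · have h := hθn.abs_sub_le hqM' (hzθ k.castSucc).1 (hzθ k.succ).1
    rw [(hzθ _).2, (hzθ _).2] at h
    have h2 : ((k.succ : Fin ((n : ℕ) + 1)) : ℕ) * Real.pi
        - ((k.castSucc : Fin ((n : ℕ) + 1)) : ℕ) * Real.pi = Real.pi := by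
      simp only [Fin.val_succ, Fin.val_castSucc]
      push_cast
      ring
    rw [h2, abs_of_pos Real.pi_pos,
      abs_of_pos (sub_pos.2 (hz Fin.castSucc_lt_succ))] at h
    refine hcc₄.trans ((div_le_iff₀ (by positivity)).2 ?_)
    linarith
  · obtain ⟨k, hk⟩ := exists_mem_Icc_succ z (s := s) (by rw [hz0]; exact hs.1.le)
      (by rw [hzL]; exact hs.2)
    have hsI : s ∈ Icc 0 L := Ioo_subset_Icc_self hs
    have hfr : ∀ j, z j ∈ frontier (nonNodalSet L fun s => r s * Real.sin (ϑ s)) := by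
      intro j
      have hj : z j ∈ {s | s ∈ Icc 0 L ∧ r s * Real.sin (ϑ s) = 0} := hzeros ▸ mem_range_self j
      refine mem_frontier_nonNodalSet hL (finite_range z) (fun x hx h0 => ?_) hj.1 hj.2
      rw [hzeros]
      exact ⟨Ioo_subset_Icc_self hx, h0⟩
    have hd : Metric.infDist s (frontier (nonNodalSet L fun s => r s * Real.sin (ϑ s)))
        ≤ min (s - z k.castSucc) (z k.succ - s) := by
      refine le_min ?_ ?_
      · refine (Metric.infDist_le_dist_of_mem (hfr k.castSucc)).trans ?_
        rw [Real.dist_eq, abs_of_nonneg (by linarith [hk.1])]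
      · refine (Metric.infDist_le_dist_of_mem (hfr k.succ)).trans ?_
        rw [Real.dist_eq, abs_of_nonpos (by linarith [hk.2])]
        linarith
    have hsin := hθn.mul_min_le_abs_sin hqM' (hzθ k.castSucc).1.1 (hzθ k.succ).1.2 hk
      (m := k) (by simpa using (hzθ k.castSucc).2) (by simpa using (hzθ k.succ).2)
    have hr' : Real.sqrt E₀ ≤ |r s| := by
      rw [← Real.sqrt_sq_eq_abs]
      exact Real.sqrt_le_sqrt (hE s hsI).1
    rw [abs_mul]
    calc c * Metric.infDist s _ ≤ c₅ * min (s - z k.castSucc) (z k.succ - s) :=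
          mul_le_mul hcc₅ hd Metric.infDist_nonneg hc₅0.le
      _ = Real.sqrt E₀ * (2 / Real.pi * ((2 + (1 + M) * L ^ 2)⁻¹ *
            min (s - z k.castSucc) (z k.succ - s))) := by
          rw [hc₅]
          ring
      _ ≤ |r s| * |Real.sin (ϑ s)| :=
          mul_le_mul hr' hsin ((by
            have h1 : 0 ≤ min (s - z k.castSucc) (z k.succ - s) :=
              le_min (by linarith [hk.1]) (by linarith [hk.2])
            positivity)) (abs_nonneg _)
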